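/- **Setting.** Let $X$ be a $\sigma$-compact metric space with its Borel $\sigma$-algebra and a $\sigma$-finite diffuse measure $\sigma$, and let $(Y,\mu)$ be a measure space. Let $\Omega^X$ be the space of locally finite subsets $\omega$ of $X$, identified with the point measures $\omega(dx)=\sum_{x\in\omega}\varepsilon_x(dx)$, with the $\sigma$-algebra generated by the counts $\omega\mapsto\omega(A)$. Let $\pi_\sigma$ be the Poisson measure on $\Omega^X$ with intensity $\sigma$, and $E_\sigma$ its expectation. For $F:\Omega^X\to\mathbb R$ let $D_xF(\omega)=F(\omega\cup\{x\})-F(\omega)$, and for a measurable process $u:\Omega^X\times X\to\mathbb R$ let $$\delta_\sigma(u)(\omega)=\int_X u_t(\omega\setminus\{t\})\,(\omega(dt)-\sigma(dt)).$$ $\mathbb L_{2,1}$ denotes the set of measurable processes $u$ with $E_\sigma\left[\int_X u_t^2\,\sigma(dt)\right]+E_\sigma\left[\int_X\int_X|D_su_t|^2\,\sigma(ds)\,\sigma(dt)\right]<\infty$. For processes $v_0,\dots,v_j$ and $s_0,\dots,s_j\in X$ let $$\Delta_{s_0}\cdots\Delta_{s_j}\Big(\prod_{p=0}^j v_p(s_p)\Big)=\sum_{\substack{\Theta_0\cup\cdots\cup\Theta_j=\{s_0,\dots,s_j\}\\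 s_0\notin\Theta_0,\dots,s_j\notin\Theta_j}}D_{\Theta_0}v_0(s_0)\cdots D_{\Theta_j}v_j(s_j),\qquad D_\Theta=\prod_{s\in\Theta}D_s .$$ **Proposition 3.1.** Let $N\ge0$ and let $R(\omega):L^p_\mu(Y)\to L^p_\sigma(X)$, $\omega\in\Omega^X$, $p=1,\dots,N+1$, be a random isometry: for each $\omega$, $R(\omega)$ is a linear, positivity preserving operator which is isometric on $L^p$ for every $p=1,\dots,N+1$ and does not depend on $p$ (for example $R(\omega)h=h\circ\tau(\omega,\cdot)$ where $\tau(\omega,\cdot):X\to Y$ maps $\sigma$ to $\mu$). Let $h\in\bigcap_{p=1}^{N+1}L^p_\mu(Y)$ be such that $Rh$ is (that is, has a version which is) an essentially bounded process in $\mathbb L_{2,1}$, and such that $$E_\sigma\left[\int_{X^{a+1}}\Big|\Delta_{s_0}\cdots\Delta_{s_a}\Big(\prod_{p=0}^a (Rh(s_p))^{l_p}\Big)\Big|\,\sigma(ds_0)\cdots\sigma(ds_a)\right]<\infty$$ for all $a\ge0$ and $l_0,\dots,l_a\ge1$ with $l_0+\cdots+l_a\le N+1$. Then for every $n=0,\dots,N$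 we have $\delta_\sigma(Rh)\in L^{n+1}(\Omega^X,\pi_\sigma)$ and $$\begin{aligned}E_\sigma[\delta_\sigma(Rh)^{n+1}]={}&\sum_{k=0}^{n-1}\binom nk\int_Y h^{n-k+1}\,d\mu\;E_\sigma[\delta_\sigma(Rh)^k]\\&+\sum_{a=0}^n\sum_{j=0}^a\sum_{b=a}^n\ \sum_{\substack{l_0+\cdots+l_a=n-b\\ l_0,\dots,l_a\ge0\\ l_{a+1},\dots,l_b=0}}\binom aj\,C^{l_0,n}_{\mathfrak L_a,b}\Big(\prod_{q=j+1}^b\int_Y h^{1+l_q}\,d\mu\Big)\\&\qquad\times E_\sigma\left[\int_{X^{j+1}}\Delta_{s_0}\cdots\Delta_{s_j}\Big(\prod_{p=0}^j(Rh(s_p))^{1+l_p}\Big)\,\sigma(ds_0)\cdots\sigma(ds_j)\right],\end{aligned}$$ where $\mathfrak L_a=(l_1,\dots,l_a)$ and $$C^{l_0,n}_{\mathfrak L_a,a+c}=(-1)^c\binom n{l_0}\,\frac{(l_1+\cdots+l_a+a+c)!}{a!\,c!\,(1+l_1)!\cdots(1+l_a)!}.$$ -/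

import Mathlib

open MeasureTheory ProbabilityTheory
open scoped ENNReal NNReal Nat

noncomputable section

namespace PoissonInvariance

/-- The configuration space over `X`: subsets of `X` that are locally finite, i.e. have finitely
many points in every compact set. (Over a σ-compact space such a set is at most countable.) -/
structure Configuration (X : Type*) [TopologicalSpace X] where
  /-- the set of points of the configuration -/
  carrier : Set X
  finite_inter_compact : ∀ K : Set X, IsCompact K → (carrier ∩ K).Finite

namespace Configuration

variable {X : Type*} [TopologicalSpace X]

/-- The configuration `ω ∪ {x}`. -/
def insert (ω : Configuration X) (x : X) : Configuration X where
  carrier := ω.carrier ∪ {x}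
  finite_inter_compact K hK := by
    rw [Set.union_inter_distrib_right]
    exact (ω.finite_inter_compact K hK).union ((Set.finite_singleton x).inter_of_left K)

/-- The configuration `ω \ {x}`. -/
def erase (ω : Configuration X) (x : X) : Configuration X where
  carrier := ω.carrier \ {x}
  finite_inter_compact K hK :=
    (ω.finite_inter_compact K hK).subset (Set.inter_subset_inter_left K Set.sdiff_subset)

/-- The point measure `∑_{x ∈ ω} ε_x`. -/
def toMeasure [MeasurableSpace X] (ω : Configuration X) : Measure X :=
  Measure.sum fun x : ω.carrier => Measure.dirac (x : X)

/-- The σ-algebra on the configuration space generated by the counting maps `ω ↦ ω(A)`,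
`A` measurable. -/
instance [MeasurableSpace X] : MeasurableSpace (Configuration X) :=
  MeasurableSpace.comap toMeasure inferInstance

end Configuration

variable {X : Type*} [TopologicalSpace X] [MeasurableSpace X]

/-- `π` is the Poisson measure on the configuration space with intensity `σ`: it is a
probability measure under which `ω(A)` is Poisson distributed with parameter `σ(A)` for every
measurable `A` with `σ(A) < ∞`, and the counts of pairwise disjoint such sets are independent. -/
structure IsPoisson (σ : Measure X) (π : Measure (Configuration X)) : Prop where
  isProbabilityMeasure : IsProbabilityMeasure π
  map_count : ∀ A : Set X, MeasurableSet A → σ A < ∞ →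
    π.map (fun ω => ω.toMeasure A) =
      (poissonMeasure (σ A).toNNReal).map (fun k : ℕ => (k : ℝ≥0∞))
  iIndepFun_count : ∀ (n : ℕ) (A : Fin n → Set X), (∀ i, MeasurableSet (A i)) →
    (∀ i, σ (A i) < ∞) → Pairwise (fun i j => Disjoint (A i) (A j)) →
    iIndepFun (fun i ω => Configuration.toMeasure ω (A i)) π

/-- The finite difference gradient `D_x F(ω) = F(ω ∪ {x}) - F(ω)`. -/
def gradD (x : X) (F : Configuration X → ℝ) : Configuration X → ℝ :=
  fun ω => F (ω.insert x) - F ω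

/-- The iterated gradient `D_Θ F = (∏_{i ∈ Θ} D_{s_i}) F`, for a set `Θ` of indices of the
points `s_0, …, s_{m-1}`. -/
def gradSet {m : ℕ} (s : Fin m → X) (Θ : Finset (Fin m)) (F : Configuration X → ℝ) :
    Configuration X → ℝ :=
  ((List.finRange m).filter (fun i => i ∈ Θ)).foldr (fun i G => gradD (s i) G) F

open Classical in
/-- `Δ_{s_0} ⋯ Δ_{s_j} (∏_{p=0}^{j} v_p(s_p))` evaluated at `ω`, for `m = j + 1` processes `v_p`:
the sum of `∏_p D_{Θ_p} v_p(s_p)` over all families `(Θ_p)_p` of subsets of the indices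
`0, …, j` whose union is everything and such that `p ∉ Θ_p` for all `p`. -/
def bigDelta {m : ℕ} (v : Fin m → Configuration X → X → ℝ) (s : Fin m → X)
    (ω : Configuration X) : ℝ :=
  ∑ Θ : Fin m → Finset (Fin m) with
      (Finset.univ.biUnion Θ = Finset.univ ∧ ∀ p, p ∉ Θ p),
    ∏ p, gradSet s (Θ p) (fun η => v p η (s p)) ω

/-- The Poisson-Skorohod integral
`δ_σ(u)(ω) = ∫_X u_t(ω \ {t}) (ω(dt) - σ(dt))`. -/
def skorohod (σ : Measure X) (u : Configuration X → X → ℝ) (ω : Configuration X) : ℝ :=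
  (∫ t, u (ω.erase t) t ∂ω.toMeasure) - ∫ t, u (ω.erase t) t ∂σ

/-- The space `𝕃_{2,1}` of measurable processes with
`E[∫ u_t² σ(dt)] + E[∫∫ |D_s u_t|² σ(ds) σ(dt)] < ∞`. -/
structure MemL21 (σ : Measure X) (π : Measure (Configuration X))
    (u : Configuration X → X → ℝ) : Prop where
  measurable : Measurable (Function.uncurry u)
  sq_lt_top : ∫⁻ ω, ∫⁻ t, ‖u ω t‖ₑ ^ 2 ∂σ ∂π < ∞
  grad_sq_lt_top : ∫⁻ ω, ∫⁻ s, ∫⁻ t, ‖gradD s (fun η => u η t) ω‖ₑ ^ 2 ∂σ ∂σ ∂π < ∞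

instance factOneLe (k : ℕ) : Fact ((1 : ℝ≥0∞) ≤ (k : ℝ≥0∞) + 1) := ⟨le_add_self⟩

/-- A random (linear, positivity preserving) isometry from `L^p_μ(Y)` to `L^p_σ(X)`
for all `p = 1, …, N + 1`. The index `p : Fin (N + 1)` stands for the exponent `p + 1`. -/
structure RandomIsometry (N : ℕ) {Y : Type*} [MeasurableSpace Y] (μ : Measure Y)
    (σ : Measure X) where
  /-- the isometry `R(ω)` on each of the spaces `L^{p+1}` -/
  toIsometry : Configuration X → (p : Fin (N + 1)) →
    (Lp ℝ (((p : ℕ) : ℝ≥0∞) + 1) μ →ₗᵢ[ℝ] Lp ℝ (((p : ℕ) : ℝ≥0∞) + 1) σ)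
  /-- `R(ω)` does not depend on the space in which a function is considered -/
  compatible : ∀ ω (p q : Fin (N + 1)) (f : Lp ℝ (((p : ℕ) : ℝ≥0∞) + 1) μ)
    (g : Lp ℝ (((q : ℕ) : ℝ≥0∞) + 1) μ), f =ᵐ[μ] g → toIsometry ω p f =ᵐ[σ] toIsometry ω q g
  /-- `R(ω)` maps nonnegative functions to nonnegative functions -/
  nonneg : ∀ ω (p : Fin (N + 1)) (f : Lp ℝ (((p : ℕ) : ℝ≥0∞) + 1) μ),
    0 ≤ f → 0 ≤ toIsometry ω p f

/-- The process `u` is a version of `Rh`: for almost all `ω`, `u(ω, ·) = R(ω)h` almost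
everywhere. -/
def IsVersion {N : ℕ} {Y : Type*} [MeasurableSpace Y] {μ : Measure Y} {σ : Measure X}
    (π : Measure (Configuration X)) (R : RandomIsometry N μ σ) (h : Y → ℝ)
    (hh : ∀ p : Fin (N + 1), MemLp h (((p : ℕ) : ℝ≥0∞) + 1) μ)
    (u : Configuration X → X → ℝ) : Prop :=
  ∀ᵐ ω ∂π, ∀ p : Fin (N + 1), u ω =ᵐ[σ] R.toIsometry ω p ((hh p).toLp h)

/-- The finite sequence `l_0, …, l_a` continued by `l_q = 0` for `q > a`. -/
def extendZero {a : ℕ} (l : Fin (a + 1) → ℕ) (q : ℕ) : ℕ :=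
  if hq : q < a + 1 then l ⟨q, hq⟩ else 0

/-- The coefficient `C_{(l_1,…,l_a), a+c}^{l_0, n}`, namely
`(-1)^c (n choose l_0) (l_1 + ⋯ + l_a + a + c)! / (a! c! ∏_{p=1}^a (1 + l_p)!)`. The last factor
is `1 / a!` times the number of ways to choose pairwise disjoint blocks `B_1, …, B_a` of sizes
`1 + l_1, …, 1 + l_a` in a set of `l_1 + ⋯ + l_a + a + c` elements, leaving `c` singletons. -/
def coeffC (n a c : ℕ) (l : Fin (a + 1) → ℕ) : ℝ :=
  (-1) ^ c * (n.choose (l 0) : ℝ) *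
    ((((∑ p : Fin a, l p.succ) + a + c)! : ℕ) /
      ((a ! : ℝ) * (c ! : ℝ) * ∏ p : Fin a, ((1 + l p.succ)! : ℝ)))

end PoissonInvariance

end

/-!
Write `I(ω) = ∫ u_t(ω \ {t}) ω(dt)`, so that `δ(u) = I - ∫ u dσ`, where `∫ u dσ` is deterministic.
By the Mecke formula a factor `I` of `E[I ^ i ⋯]` is traded for a new point `s`, which is added to
the configuration and splits the remaining factors into copies of `u_s` and of `I`. Iterating,
`E[I ^ i]` is a sum over the partitions of `i` elements of the joint moments
`E ∫ ∏_p u(s_p)^{k_p}(ω ∪ {s_q : q ≠ p}) σ(ds)`, where `k_p` are the block sizes. As the integrals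
`∫ u ^ k dσ` are deterministic, the integral of `Δ_{s_0} ⋯ Δ_{s_j} ∏_p u(s_p)^{k_p}` is the Möbius
transform of these joint moments over the subsets of the blocks. Conditioning on the block of one
distinguished factor, the centring at its block gives the first sum of the recursion and the
inverse Möbius transform over the other blocks gives the second; the binomial expansion of
`(I - ∫ u dσ) ^ (n + 1)` contributes the `b - a` indices `l_q = 0` of the coefficient `C`.
-/

noncomputable section

namespace PoissonInvariance

theorem isSFiniteKernel_of_lt_top {α β : Type*} [MeasurableSpace α] [MeasurableSpace β]
    {κ : Kernel α β} (hκ : ∀ a, κ a Set.univ < ∞) : IsSFiniteKernel κ := by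
  have hmass : Measurable fun a => κ a Set.univ := κ.measurable_coe MeasurableSet.univ
  let κ₁ : Kernel α β :=
    { toFun := fun a => (κ a Set.univ)⁻¹ • κ a
      measurable' := Measure.measurable_of_measurable_coe _ fun A hA => by
        simp only [Measure.smul_apply, smul_eq_mul]
        exact hmass.inv.mul (κ.measurable_coe hA) }
  have hκ₁ (a : α) : κ₁ a = (κ a Set.univ)⁻¹ • κ a := rfl
  have : IsFiniteKernel κ₁ := ⟨⟨1, ENNReal.one_lt_top, fun a => by
    simpa only [hκ₁, Measure.smul_apply, smul_eq_mul] using ENNReal.inv_mul_le_one _⟩⟩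
  have hdensity : κ = κ₁.withDensity fun a _ => κ a Set.univ := by
    ext1 a
    have hmass' : Measurable (Function.uncurry fun (a : α) (_ : β) => κ a Set.univ) :=
      hmass.comp measurable_fst
    rw [Kernel.withDensity_apply _ hmass', withDensity_const, hκ₁, smul_smul]
    rcases eq_or_ne (κ a Set.univ) 0 with h | h
    · rw [Measure.measure_univ_eq_zero.1 h, smul_zero]
    · rw [ENNReal.mul_inv_cancel h (hκ a).ne, one_smul]
  rw [hdensity]
  exact Kernel.IsSFiniteKernel.withDensity _ fun a _ => (hκ a).ne

namespace Configuration

variable {X : Type*} [TopologicalSpace X]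

@[ext]
theorem ext {ω η : Configuration X} (h : ω.carrier = η.carrier) : ω = η := by
  cases ω; cases η; cases h; rfl

theorem countable_carrier [SigmaCompactSpace X] (ω : Configuration X) : ω.carrier.Countable := by
  have hcover : ω.carrier = ⋃ n, ω.carrier ∩ compactCovering X n := by
    rw [← Set.inter_iUnion, iUnion_compactCovering, Set.inter_univ]
  rw [hcover]
  exact Set.countable_iUnion fun n =>
    (ω.finite_inter_compact _ (isCompact_compactCovering X n)).countable

theorem insert_erase (ω : Configuration X) (x : X) : (ω.erase x).insert x = ω.insert x := by
  ext1; simp [insert, erase]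

theorem erase_insert {ω : Configuration X} {x : X} (h : x ∉ ω.carrier) :
    (ω.insert x).erase x = ω := by
  ext1; simp [insert, erase, h]

theorem erase_eq {ω : Configuration X} {x : X} (h : x ∉ ω.carrier) : ω.erase x = ω := by
  ext1; simp [erase, h]

variable [MeasurableSpace X]

theorem ae_notMem_carrier [SigmaCompactSpace X] (σ : Measure X) [NullSingletonClass σ]
    (ω : Configuration X) : ∀ᵐ x ∂σ, x ∉ ω.carrier :=
  ω.countable_carrier.ae_notMem σ

theorem toMeasure_apply (ω : Configuration X) {A : Set X} (hA : MeasurableSet A) :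
    ω.toMeasure A = ∑' x, ω.carrier.indicator (A.indicator 1) x := by
  rw [toMeasure, Measure.sum_apply _ hA, ← tsum_subtype]
  simp [Measure.dirac_apply' _ hA]

theorem toMeasure_lt_top (ω : Configuration X) {K : Set X} (hK : IsCompact K)
    (hKm : MeasurableSet K) : ω.toMeasure K < ∞ := by
  rw [ω.toMeasure_apply hKm, Set.indicator_indicator,
    tsum_eq_sum (s := (ω.finite_inter_compact K hK).toFinset)]
  · exact ENNReal.sum_lt_top.2 fun x _ => by
      by_cases h : x ∈ ω.carrier ∩ K <;> simp [Set.indicator, h]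
  · intro x hx
    rw [Set.Finite.mem_toFinset] at hx
    simp [Set.indicator_of_notMem hx]

theorem toMeasure_insert {ω : Configuration X} {x : X} (h : x ∉ ω.carrier) :
    (ω.insert x).toMeasure = ω.toMeasure + Measure.dirac x := by
  ext A hA
  rw [Measure.add_apply, toMeasure_apply _ hA, toMeasure_apply _ hA, insert,
    Set.indicator_union_of_disjoint (Set.disjoint_singleton_right.2 h), ENNReal.tsum_add,
    Measure.dirac_apply' _ hA]
  congr 1
  rw [tsum_eq_single x fun y hy => by simp [hy]]
  simp

section Singletons

variable [MeasurableSingletonClass X]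

theorem lintegral_toMeasure (ω : Configuration X) (f : X → ℝ≥0∞) :
    ∫⁻ x, f x ∂ω.toMeasure = ∑' x : ω.carrier, f x := by
  rw [toMeasure, lintegral_sum_measure]
  simp

theorem ae_toMeasure_iff [SigmaCompactSpace X] (ω : Configuration X) {p : X → Prop} :
    (∀ᵐ x ∂ω.toMeasure, p x) ↔ ∀ x ∈ ω.carrier, p x := by
  have := ω.countable_carrier.to_subtype
  rw [toMeasure, Measure.ae_sum_iff]
  simp [ae_dirac_eq]

theorem toMeasure_erase (ω : Configuration X) (x : X) :
    (ω.erase x).toMeasure = ω.toMeasure.restrict {x}ᶜ := by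
  ext A hA
  rw [Measure.restrict_apply hA, toMeasure_apply _ hA,
    toMeasure_apply _ (hA.inter (measurableSet_singleton x).compl), Set.indicator_indicator,
    Set.indicator_indicator]
  congr! 3
  simp only [erase]
  tauto_set

end Singletons

theorem measurable_toMeasure : Measurable (toMeasure : Configuration X → Measure X) :=
  comap_measurable _

theorem measurable_count {A : Set X} (hA : MeasurableSet A) :
    Measurable fun ω : Configuration X => ω.toMeasure A :=
  (Measure.measurable_coe hA).comp measurable_toMeasure

theorem measurable_of_count {Z : Type*} [MeasurableSpace Z] {f : Z → Configuration X}
    (hf : ∀ A : Set X, MeasurableSet A → Measurable fun z => (f z).toMeasure A) :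
    Measurable f :=
  measurable_comap_iff.2 (Measure.measurable_of_measurable_coe _ hf)

variable (X) in
/-- The kernel `ω ↦ ω(dx)`. -/
def countKernel : Kernel (Configuration X) X where
  toFun := toMeasure
  measurable' := measurable_toMeasure

@[simp]
theorem countKernel_apply (ω : Configuration X) : countKernel X ω = ω.toMeasure := rfl

variable [SigmaCompactSpace X] [T2Space X] [OpensMeasurableSpace X]

instance : IsSFiniteKernel (countKernel X) := by
  have hK (n : ℕ) : MeasurableSet (compactCovering X n) :=
    (isCompact_compactCovering X n).measurableSet
  have hm (n : ℕ) : MeasurableSet (disjointed (compactCovering X) n) := .disjointed hK n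
  have hsum : countKernel X = Kernel.sum fun n => (countKernel X).restrict (hm n) := by
    ext1 ω
    simp only [Kernel.sum_apply, Kernel.restrict_apply]
    rw [← Measure.restrict_iUnion (disjoint_disjointed _) hm, iUnion_disjointed,
      iUnion_compactCovering, Measure.restrict_univ]
  have (n : ℕ) : IsSFiniteKernel ((countKernel X).restrict (hm n)) :=
    isSFiniteKernel_of_lt_top fun ω => by
      rw [Kernel.restrict_apply, Measure.restrict_apply_univ]
      exact (measure_mono (disjointed_subset _ _)).trans_lt
        (ω.toMeasure_lt_top (isCompact_compactCovering X n) (hK n))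
  rw [hsum]
  infer_instance

section Points

variable [SecondCountableTopology X] {Z : Type*} [MeasurableSpace Z]
  {f : Z → Configuration X} {g : Z → X}

theorem measurable_count_compl_singleton {A : Set X} (hA : MeasurableSet A) :
    Measurable fun z : Configuration X × X => z.1.toMeasure (A ∩ {z.2}ᶜ) := by
  have hs : MeasurableSet {z : (Configuration X × X) × X | z.2 ∈ A ∧ z.2 ≠ z.1.2} :=
    (measurable_snd hA).inter (measurableSet_eq_fun measurable_snd measurable_fst.snd).compl
  simpa only [Kernel.prodMkRight_apply, countKernel_apply] using!
    Kernel.measurable_kernel_prodMk_left (κ := (countKernel X).prodMkRight X) hs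

theorem measurable_erase (hf : Measurable f) (hg : Measurable g) :
    Measurable fun z => (f z).erase (g z) := by
  suffices h : Measurable fun z : Configuration X × X => z.1.erase z.2 from
    h.comp (hf.prodMk hg)
  refine measurable_of_count fun A hA => ?_
  simp only [toMeasure_erase, Measure.restrict_apply hA]
  exact measurable_count_compl_singleton hA

theorem measurable_insert (hf : Measurable f) (hg : Measurable g) :
    Measurable fun z => (f z).insert (g z) := by
  suffices h : Measurable fun z : Configuration X × X => z.1.insert z.2 from
    h.comp (hf.prodMk hg)
  refine measurable_of_count fun A hA => ?_
  have hcount (z : Configuration X × X) : (z.1.insert z.2).toMeasure A =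
      z.1.toMeasure (A ∩ {z.2}ᶜ) + A.indicator 1 z.2 := by
    rw [← insert_erase, toMeasure_insert (by simp [erase]), toMeasure_erase, Measure.add_apply,
      Measure.restrict_apply hA, Measure.dirac_apply' _ hA]
  simp only [hcount]
  exact (measurable_count_compl_singleton hA).add
    ((measurable_one.indicator hA).comp measurable_snd)

end Points

end Configuration

open PoissonInvariance.Configuration

theorem lintegral_pi_mul_eq {ι : Type*} [Fintype ι] [DecidableEq ι] {α : ι → Type*}
    [∀ i, MeasurableSpace (α i)] (ν : ∀ i, Measure (α i)) [∀ i, SigmaFinite (ν i)] (i : ι)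
    {w : α i → ℝ≥0∞} (hw : Measurable w) {τ : α i → α i} (hτ : Measurable τ) {c : ℝ≥0∞}
    (h : ∀ f : α i → ℝ≥0∞, Measurable f → ∫⁻ x, f x * w x ∂ν i = c * ∫⁻ x, f (τ x) ∂ν i)
    {g : (∀ i, α i) → ℝ≥0∞} (hg : Measurable g) :
    ∫⁻ y, g y * w (y i) ∂Measure.pi ν =
      c * ∫⁻ y, g (Function.update y i (τ (y i))) ∂Measure.pi ν := by
  have hcoord : Measurable fun y : ∀ i, α i => y i := measurable_pi_apply i
  have hupd : Measurable fun y : ∀ i, α i => Function.update y i (τ (y i)) :=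
    measurable_update'.comp (measurable_id.prodMk (hτ.comp hcoord))
  have hgupd : Measurable fun y : ∀ i, α i => g (Function.update y i (τ (y i))) := hg.comp hupd
  have hgw : Measurable fun y : ∀ i, α i => g y * w (y i) := hg.mul (hw.comp hcoord)
  rw [← lintegral_const_mul _ hgupd]
  rcases isEmpty_or_nonempty (∀ i, α i) with hα | ⟨⟨y⟩⟩
  · simp
  rw [lintegral_eq_lmarginal_univ y, lintegral_eq_lmarginal_univ y,
    lmarginal_erase' _ hgw (Finset.mem_univ i),
    lmarginal_erase' _ (hgupd.const_mul c) (Finset.mem_univ i)]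
  congr 1
  funext z
  have hgz : Measurable fun x => g (Function.update z i x) := hg.comp (measurable_update z)
  simp only [Function.update_self, Function.update_idem]
  rw [h _ hgz]
  exact (lintegral_const_mul c (hgz.comp hτ)).symm

/-- The Poisson law with mean `r`, as a measure on `ℝ≥0∞`, where the counts `ω(A)` take their
values. -/
def ennrealPoisson (r : ℝ≥0) : Measure ℝ≥0∞ :=
  (poissonMeasure r).map fun k : ℕ => (k : ℝ≥0∞)

instance (r : ℝ≥0) : IsProbabilityMeasure (ennrealPoisson r) :=
  Measure.isProbabilityMeasure_map Measurable.of_discrete.aemeasurable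

theorem lintegral_mul_ennrealPoisson (r : ℝ≥0) {f : ℝ≥0∞ → ℝ≥0∞} (hf : Measurable f) :
    ∫⁻ x, f x * x ∂ennrealPoisson r = r * ∫⁻ x, f (x + 1) ∂ennrealPoisson r := by
  have hweight (k : ℕ) :
      ENNReal.ofReal (Real.exp (-r) * r ^ (k + 1) / (k + 1)!) * ((k + 1 : ℕ) : ℝ≥0∞) =
        r * ENNReal.ofReal (Real.exp (-r) * r ^ k / k !) := by
    rw [← ENNReal.ofReal_natCast, ← ENNReal.ofReal_coe_nnreal,
      ← ENNReal.ofReal_mul (by positivity), ← ENNReal.ofReal_mul (by positivity)]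
    congr 1
    rw [Nat.factorial_succ]
    push_cast
    field_simp
    ring
  have hf₁ : Measurable fun x => f x * x := hf.mul measurable_id
  have hf₂ : Measurable fun x => f (x + 1) := hf.comp (measurable_id.add_const 1)
  rw [ennrealPoisson, lintegral_map hf₁ .of_discrete, lintegral_map hf₂ .of_discrete,
    poissonMeasure]
  simp only [lintegral_sum_measure, lintegral_smul_measure, lintegral_dirac, smul_eq_mul]
  rw [tsum_eq_zero_add' ENNReal.summable, ← ENNReal.tsum_mul_left]
  simp only [Nat.cast_zero, mul_zero, zero_add]
  refine tsum_congr fun k => ?_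
  rw [← mul_assoc (r : ℝ≥0∞), ← hweight, Nat.cast_succ]
  ring

section VennCell

variable {α ι : Type*} {B : ι → Set α} {S T : Finset ι} {i : ι}

/-- The points lying in exactly those sets of the family `B` whose index is in `T`. The cell with
`T = ∅` is taken to be empty, so that every cell has finite measure as soon as the `B i` do. -/
def vennCell (B : ι → Set α) (T : Finset ι) : Set α :=
  {x | T.Nonempty ∧ ∀ i, x ∈ B i ↔ i ∈ T}

theorem vennCell_subset (hi : i ∈ T) : vennCell B T ⊆ B i :=
  fun _ hx => (hx.2 i).2 hi

theorem pairwise_disjoint_vennCell (B : ι → Set α) :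
    Pairwise fun S T => Disjoint (vennCell B S) (vennCell B T) := fun _ _ hST =>
  Set.disjoint_left.2 fun _ hS hT => hST (Finset.ext fun i => (hS.2 i).symm.trans (hT.2 i))

theorem iUnion_vennCell [Fintype ι] [DecidableEq ι] (B : ι → Set α) (i : ι) :
    ⋃ T ∈ Finset.univ.filter fun T : Finset ι => i ∈ T, vennCell B T = B i := by
  classical
  refine subset_antisymm (Set.iUnion₂_subset fun T hT =>
    vennCell_subset (Finset.mem_filter.1 hT).2) fun x hx => ?_
  have hi : i ∈ Finset.univ.filter fun j => x ∈ B j := by simpa using hx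
  exact Set.mem_biUnion (by simpa using hx) ⟨⟨i, hi⟩, by simp⟩

variable [MeasurableSpace α]

theorem measurableSet_vennCell [Countable ι] (hB : ∀ i, MeasurableSet (B i)) (T : Finset ι) :
    MeasurableSet (vennCell B T) :=
  measurableSet_setOfPred.2 <| measurable_const.and <| .forall fun i =>
    (measurableSet_setOfPred.1 (hB i)).iff measurable_const

theorem measure_vennCell_lt_top {σ : Measure α} (hσ : ∀ i, σ (B i) < ∞) (T : Finset ι) :
    σ (vennCell B T) < ∞ := by
  rcases T.eq_empty_or_nonempty with rfl | ⟨i, hi⟩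
  · simp [vennCell]
  · exact (measure_mono (vennCell_subset hi)).trans_lt (hσ i)

theorem measure_eq_sum_vennCell [Fintype ι] [DecidableEq ι] (hB : ∀ i, MeasurableSet (B i))
    (ρ : Measure α) (i : ι) : ρ (B i) = ∑ T : Finset ι with i ∈ T, ρ (vennCell B T) := by
  rw [← iUnion_vennCell B i, measure_biUnion_finset
    (fun S _ T _ hST => pairwise_disjoint_vennCell B hST) fun T _ => measurableSet_vennCell hB T]

end VennCell

namespace IsPoisson

variable {X : Type*} [TopologicalSpace X] [MeasurableSpace X] {σ : Measure X}
  {π : Measure (Configuration X)}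

theorem map_count_pi (hπ : IsPoisson σ π) {ι : Type*} [Fintype ι] {A : ι → Set X}
    (hA : ∀ i, MeasurableSet (A i)) (hσ : ∀ i, σ (A i) < ∞)
    (hd : Pairwise fun i j => Disjoint (A i) (A j)) :
    π.map (fun ω i => ω.toMeasure (A i)) =
      Measure.pi fun i => ennrealPoisson (σ (A i)).toNNReal := by
  have := hπ.isProbabilityMeasure
  let e := Fintype.equivFin ι
  have hindep : iIndepFun (fun i ω => toMeasure ω (A i)) π := by
    have := (hπ.iIndepFun_count _ (fun i => A (e.symm i)) (fun i => hA _) (fun i => hσ _)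
      fun i j hij => hd (e.symm.injective.ne hij)).precomp e.injective
    simpa only [Function.comp_def, Equiv.symm_apply_apply] using this
  rw [(iIndepFun_iff_map_fun_eq_pi_map fun i => (measurable_count (hA i)).aemeasurable).1 hindep]
  congr! with i
  exact hπ.map_count _ (hA i) (hσ i)

theorem lintegral_mul_count_update (hπ : IsPoisson σ π) {ι : Type*} [Finite ι] [DecidableEq ι]
    {A : ι → Set X} (hA : ∀ i, MeasurableSet (A i)) (hσ : ∀ i, σ (A i) < ∞)
    (hd : Pairwise fun i j => Disjoint (A i) (A j)) {g : (ι → ℝ≥0∞) → ℝ≥0∞}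
    (hg : Measurable g) (i : ι) :
    ∫⁻ ω, g (fun j => ω.toMeasure (A j)) * ω.toMeasure (A i) ∂π =
      σ (A i) * ∫⁻ ω, g (Function.update (fun j => ω.toMeasure (A j)) i
        (ω.toMeasure (A i) + 1)) ∂π := by
  cases nonempty_fintype ι
  have hN : Measurable fun (ω : Configuration X) j => ω.toMeasure (A j) :=
    measurable_pi_lambda _ fun j => measurable_count (hA j)
  have hcoord : Measurable fun y : ι → ℝ≥0∞ => y i := measurable_pi_apply i
  have hleft : Measurable fun y : ι → ℝ≥0∞ => g y * y i := hg.mul hcoord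
  have hright : Measurable fun y : ι → ℝ≥0∞ => g (Function.update y i (y i + 1)) :=
    hg.comp (measurable_update'.comp (measurable_id.prodMk (hcoord.add_const 1)))
  rw [← lintegral_map hleft hN, ← lintegral_map hright hN, hπ.map_count_pi hA hσ hd]
  refine lintegral_pi_mul_eq (fun j => ennrealPoisson (σ (A j)).toNNReal) i measurable_id
    (measurable_id.add_const 1) (fun f hf => ?_) hg
  rw [← ENNReal.coe_toNNReal (hσ i).ne]
  exact lintegral_mul_ennrealPoisson _ hf

variable [MeasurableSingletonClass X] [NullSingletonClass σ]

theorem ae_notMem_carrier (hπ : IsPoisson σ π) (x : X) : ∀ᵐ ω ∂π, x ∉ ω.carrier := by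
  have hx := measurableSet_singleton x
  have hmean : ∫⁻ ω, toMeasure ω {x} ∂π = 0 := by
    simpa using hπ.lintegral_mul_count_update (A := fun _ : Unit => {x}) (fun _ => hx) (by simp)
      (Subsingleton.pairwise) (g := fun _ => 1) measurable_const ()
  rw [lintegral_eq_zero_iff (measurable_count hx)] at hmean
  filter_upwards [hmean] with ω hω hxω
  rw [Pi.zero_apply, toMeasure_apply _ hx, ENNReal.tsum_eq_zero] at hω
  simpa [hxω] using hω x

theorem lintegral_mul_count_of_disjoint (hπ : IsPoisson σ π) {ι : Type*} [Finite ι]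
    {A : ι → Set X} (hA : ∀ i, MeasurableSet (A i)) (hσ : ∀ i, σ (A i) < ∞)
    (hd : Pairwise fun i j => Disjoint (A i) (A j)) {g : (ι → ℝ≥0∞) → ℝ≥0∞}
    (hg : Measurable g) (i : ι) :
    ∫⁻ ω, g (fun j => ω.toMeasure (A j)) * ω.toMeasure (A i) ∂π =
      ∫⁻ x in A i, ∫⁻ ω, g (fun j => (ω.insert x).toMeasure (A j)) ∂π ∂σ := by
  classical
  have hinsert (x : X) (hx : x ∈ A i) :
      ∫⁻ ω, g (fun j => (ω.insert x).toMeasure (A j)) ∂π =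
        ∫⁻ ω, g (Function.update (fun j => ω.toMeasure (A j)) i (ω.toMeasure (A i) + 1)) ∂π := by
    refine lintegral_congr_ae ?_
    filter_upwards [hπ.ae_notMem_carrier x] with ω hω
    congr 1
    funext j
    rw [toMeasure_insert hω, Measure.add_apply, Measure.dirac_apply' _ (hA j)]
    rcases eq_or_ne j i with rfl | hji
    · simp [hx]
    · simp [hji, Set.disjoint_left.1 (hd hji.symm) hx]
  rw [hπ.lintegral_mul_count_update hA hσ hd hg, setLIntegral_congr_fun (hA i) hinsert,
    setLIntegral_const, mul_comm]

theorem lintegral_mul_count (hπ : IsPoisson σ π) {ι : Type*} [Finite ι] {B : ι → Set X}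
    (hB : ∀ i, MeasurableSet (B i)) (hσ : ∀ i, σ (B i) < ∞) {g : (ι → ℝ≥0∞) → ℝ≥0∞}
    (hg : Measurable g) (i : ι) :
    ∫⁻ ω, g (fun j => ω.toMeasure (B j)) * ω.toMeasure (B i) ∂π =
      ∫⁻ x in B i, ∫⁻ ω, g (fun j => (ω.insert x).toMeasure (B j)) ∂π ∂σ := by
  classical
  cases nonempty_fintype ι
  have hcell := measurableSet_vennCell hB
  have hdisj := pairwise_disjoint_vennCell B
  let ψ : (Finset ι → ℝ≥0∞) → ι → ℝ≥0∞ := fun y j => ∑ T with j ∈ T, y T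
  have hψ : Measurable ψ := measurable_pi_lambda _ fun j =>
    Finset.measurable_fun_sum _ fun T _ => measurable_pi_apply T
  have hcount (ω : Configuration X) :
      (fun j => ω.toMeasure (B j)) = ψ fun T => ω.toMeasure (vennCell B T) :=
    funext fun j => measure_eq_sum_vennCell hB _ j
  have hm (T : Finset ι) : Measurable fun ω : Configuration X =>
      g (fun j => ω.toMeasure (B j)) * ω.toMeasure (vennCell B T) :=
    (hg.comp (measurable_pi_lambda _ fun j => measurable_count (hB j))).mul
      (measurable_count (hcell T))
  calc ∫⁻ ω, g (fun j => ω.toMeasure (B j)) * ω.toMeasure (B i) ∂π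
      = ∑ T with i ∈ T, ∫⁻ ω, g (fun j => ω.toMeasure (B j)) * ω.toMeasure (vennCell B T) ∂π := by
        rw [← lintegral_finsetSum _ fun T _ => hm T]
        exact lintegral_congr fun ω => by rw [measure_eq_sum_vennCell hB _ i, Finset.mul_sum]
    _ = ∑ T with i ∈ T, ∫⁻ x in vennCell B T,
          ∫⁻ ω, g (fun j => (ω.insert x).toMeasure (B j)) ∂π ∂σ := by
        simp only [hcount]
        exact Finset.sum_congr rfl fun T _ => hπ.lintegral_mul_count_of_disjoint hcell
          (measure_vennCell_lt_top hσ) hdisj (hg.comp hψ) T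
    _ = ∫⁻ x in B i, ∫⁻ ω, g (fun j => (ω.insert x).toMeasure (B j)) ∂π ∂σ := by
        rw [← iUnion_vennCell B i,
          lintegral_biUnion_finset (fun S _ T _ hST => hdisj hST) fun T _ => hcell T]

end IsPoisson

section CountExt

variable {X : Type*} [TopologicalSpace X] [MeasurableSpace X] (σ : Measure X) [SigmaFinite σ]

theorem measurable_of_count_lt_top {Z : Type*} [MeasurableSpace Z] {f : Z → Configuration X}
    (hf : ∀ B : Set X, MeasurableSet B → σ B < ∞ → Measurable fun z => (f z).toMeasure B) :
    Measurable f := by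
  refine measurable_of_count fun B hB => ?_
  have hsup (z : Z) : (f z).toMeasure B = ⨆ n, (f z).toMeasure (B ∩ spanningSets σ n) := by
    rw [← Monotone.measure_iUnion, ← Set.inter_iUnion, iUnion_spanningSets, Set.inter_univ]
    exact fun i j hij => Set.inter_subset_inter_right _ (monotone_spanningSets σ hij)
  simp only [hsup]
  exact .iSup fun n => hf _ (hB.inter (measurableSet_spanningSets σ n))
    ((measure_mono Set.inter_subset_right).trans_lt (measure_spanningSets_lt_top σ n))

theorem ext_of_map_count {ρ₁ ρ₂ : Measure (Configuration X)} [IsFiniteMeasure ρ₁]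
    (h : ∀ I : Finset {B : Set X // MeasurableSet B ∧ σ B < ∞},
      ρ₁.map (fun ω (B : I) => ω.toMeasure B) = ρ₂.map fun ω (B : I) => ω.toMeasure B) :
    ρ₁ = ρ₂ := by
  let counts : Configuration X → {B : Set X // MeasurableSet B ∧ σ B < ∞} → ℝ≥0∞ :=
    fun ω B => ω.toMeasure B
  have hcounts : Measurable counts := measurable_pi_lambda _ fun B => measurable_count B.2.1
  have hid : Measurable[MeasurableSpace.comap counts inferInstance] id :=
    @measurable_of_count_lt_top _ _ _ σ _ _ (MeasurableSpace.comap counts inferInstance) _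
      fun B hB hσB =>
        (measurable_pi_apply (⟨B, hB, hσB⟩ : {B : Set X // MeasurableSet B ∧ σ B < ∞})).comp
          (comap_measurable counts)
  have hmap : ρ₁.map counts = ρ₂.map counts := by
    refine IsProjectiveLimit.unique (P := fun I => (ρ₁.map counts).map I.restrict)
      (fun I => rfl) fun I => ?_
    simpa only [Measure.map_map (Finset.measurable_restrict I) hcounts] using! (h I).symm
  ext E hE
  obtain ⟨U, hU, rfl : counts ⁻¹' U = E⟩ := hid hE
  rw [← Measure.map_apply hcounts hU, hmap, Measure.map_apply hcounts hU]

end CountExt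

theorem Configuration.measurable_insert_prod {X : Type*} [TopologicalSpace X] [T2Space X]
    [SecondCountableTopology X] [SigmaCompactSpace X] [MeasurableSpace X]
    [OpensMeasurableSpace X] : Measurable fun z : Configuration X × X => (z.1.insert z.2, z.2) :=
  (measurable_insert measurable_fst measurable_snd).prodMk measurable_snd

namespace IsPoisson

variable {X : Type*} [TopologicalSpace X] [T2Space X] [SecondCountableTopology X]
  [SigmaCompactSpace X] [MeasurableSpace X] [OpensMeasurableSpace X]
  {σ : Measure X} [SigmaFinite σ] [NullSingletonClass σ] {π : Measure (Configuration X)}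

theorem withDensity_count (hπ : IsPoisson σ π) {C : Set X} (hC : MeasurableSet C)
    (hσC : σ C < ∞) :
    π.withDensity (fun ω => ω.toMeasure C) =
      (π.prod (σ.restrict C)).map fun z => z.1.insert z.2 := by
  have := hπ.isProbabilityMeasure
  have : IsFiniteMeasure (σ.restrict C) := isFiniteMeasure_restrict.2 hσC.ne
  have hinsert : Measurable fun z : Configuration X × X => z.1.insert z.2 :=
    measurable_insert measurable_fst measurable_snd
  refine (ext_of_map_count σ fun I => Measure.ext_of_lintegral _ fun g hg => ?_).symm
  have hcounts : Measurable fun ω : Configuration X => fun B : I => ω.toMeasure B :=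
    measurable_pi_lambda _ fun B => measurable_count B.1.2.1
  let B : Option I → Set X := fun i => i.elim C fun B => B
  have hB : ∀ i, MeasurableSet (B i) := Option.forall.2 ⟨hC, fun B => B.1.2.1⟩
  have hσB : ∀ i, σ (B i) < ∞ := Option.forall.2 ⟨hσC, fun B => B.1.2.2⟩
  have hg' : Measurable fun y : Option I → ℝ≥0∞ => g fun B => y (some B) :=
    hg.comp (measurable_pi_lambda _ fun B => measurable_pi_apply _)
  have hgω : Measurable fun ω : Configuration X => g fun B : I => ω.toMeasure B := hg.comp hcounts
  have hgins : Measurable fun z : Configuration X × X =>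
      g fun B : I => (z.1.insert z.2).toMeasure B := hgω.comp hinsert
  rw [lintegral_map hg hcounts, lintegral_map hg hcounts, lintegral_map hgω hinsert,
    lintegral_withDensity_eq_lintegral_mul _ (measurable_count hC) hgω,
    lintegral_prod_symm _ hgins.aemeasurable]
  simp only [Pi.mul_apply, mul_comm (Configuration.toMeasure _ C)]
  exact (hπ.lintegral_mul_count hB hσB hg' none).symm

theorem compProd_countKernel_prod (hπ : IsPoisson σ π) {E : Set (Configuration X)} {C : Set X}
    (hE : MeasurableSet E) (hC : MeasurableSet C) (hσC : σ C < ∞) :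
    π.compProd (countKernel X) (E ×ˢ C) =
      (π.prod σ).map (fun z => (z.1.insert z.2, z.2)) (E ×ˢ C) := by
  have := hπ.isProbabilityMeasure
  have hinsert : Measurable fun z : Configuration X × X => z.1.insert z.2 :=
    measurable_insert measurable_fst measurable_snd
  calc π.compProd (countKernel X) (E ×ˢ C)
      = π.withDensity (fun ω => ω.toMeasure C) E := by
        rw [Measure.compProd_apply_prod hE hC, withDensity_apply _ hE]
        rfl
    _ = (π.prod σ) ((fun z => z.1.insert z.2) ⁻¹' E ∩ Set.univ ×ˢ C) := by
        rw [hπ.withDensity_count hC hσC, Measure.map_apply hinsert hE,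
          ← Measure.restrict_apply (hinsert hE), ← Measure.prod_restrict, Measure.restrict_univ]
    _ = _ := by
        rw [Measure.map_apply measurable_insert_prod (hE.prod hC)]
        congr 1
        ext z
        simp

theorem compProd_countKernel (hπ : IsPoisson σ π) :
    π.compProd (countKernel X) = (π.prod σ).map fun z => (z.1.insert z.2, z.2) := by
  have := hπ.isProbabilityMeasure
  refine Measure.ext_of_iUnion_eq_univ
    (s := fun n => (Set.univ : Set (Configuration X)) ×ˢ spanningSets σ n) ?_ fun n => ?_
  · rw [← Set.prod_iUnion, iUnion_spanningSets, Set.univ_prod_univ]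
  have hn := measurableSet_spanningSets σ n
  have hσn := measure_spanningSets_lt_top σ n
  have : IsFiniteMeasure ((π.compProd (countKernel X)).restrict
      (Set.univ ×ˢ spanningSets σ n)) := by
    have hpre : (fun z : Configuration X × X => (z.1.insert z.2, z.2)) ⁻¹'
        Set.univ ×ˢ spanningSets σ n = Set.univ ×ˢ spanningSets σ n := by ext z; simp
    rw [isFiniteMeasure_restrict, hπ.compProd_countKernel_prod .univ hn hσn,
      Measure.map_apply measurable_insert_prod (MeasurableSet.univ.prod hn), hpre,
      Measure.prod_prod, measure_univ, one_mul]
    exact hσn.ne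
  refine Measure.ext_prod fun {E C} hE hC => ?_
  rw [Measure.restrict_apply (hE.prod hC), Measure.restrict_apply (hE.prod hC),
    Set.prod_inter_prod, Set.inter_univ]
  exact hπ.compProd_countKernel_prod hE (hC.inter hn)
    ((measure_mono Set.inter_subset_right).trans_lt hσn)

theorem lintegral_lintegral_toMeasure (hπ : IsPoisson σ π)
    {f : Configuration X × X → ℝ≥0∞} (hf : Measurable f) :
    ∫⁻ ω, ∫⁻ t, f (ω, t) ∂ω.toMeasure ∂π = ∫⁻ ω, ∫⁻ t, f (ω.insert t, t) ∂σ ∂π := by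
  have := hπ.isProbabilityMeasure
  have hfins : Measurable fun z : Configuration X × X => f (z.1.insert z.2, z.2) :=
    hf.comp measurable_insert_prod
  have h := congrArg (fun ν => ∫⁻ z, f z ∂ν) hπ.compProd_countKernel
  simp only [lintegral_map hf measurable_insert_prod] at h
  rwa [Measure.lintegral_compProd hf, lintegral_prod _ hfins.aemeasurable] at h

theorem prod_compProd_countKernel (hπ : IsPoisson σ π) {S : Type*} [MeasurableSpace S]
    (ρ : Measure S) [SFinite ρ] :
    (π.prod ρ).compProd ((countKernel X).prodMkRight S) =
      ((π.prod ρ).prod σ).map fun z => ((z.1.1.insert z.2, z.1.2), z.2) := by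
  have := hπ.isProbabilityMeasure
  have hins : Measurable fun z : (Configuration X × S) × X =>
      ((z.1.1.insert z.2, z.1.2), z.2) :=
    ((measurable_insert measurable_fst.fst measurable_snd).prodMk
      measurable_fst.snd).prodMk measurable_snd
  refine Measure.ext_of_lintegral _ fun f hf => ?_
  have hfins : Measurable fun z : (Configuration X × S) × X =>
      f ((z.1.1.insert z.2, z.1.2), z.2) := hf.comp hins
  rw [Measure.lintegral_compProd hf, lintegral_map hf hins, lintegral_prod _ hfins.aemeasurable,
    lintegral_prod_symm, lintegral_prod_symm]
  · refine lintegral_congr fun s => ?_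
    exact hπ.lintegral_lintegral_toMeasure (f := fun z : Configuration X × X => f ((z.1, s), z.2))
      (hf.comp ((measurable_fst.prodMk measurable_const).prodMk measurable_snd))
  · exact hfins.lintegral_prod_right'.aemeasurable
  · exact (hf.lintegral_kernel_prod_right' (κ := (countKernel X).prodMkRight S)).aemeasurable

theorem ae_insert (hπ : IsPoisson σ π) {p : Configuration X → Prop} (hp : ∀ᵐ ω ∂π, p ω) :
    ∀ᵐ z ∂π.prod σ, p (z.1.insert z.2) := by
  have := hπ.isProbabilityMeasure
  have hfst : ∀ᵐ z ∂π.compProd (countKernel X), z.1 ∉ toMeasurable π {ω | ¬p ω} :=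
    Measure.ae_compProd_of_ae_fst _ (measurableSet_toMeasurable ..).compl <| by
      rwa [← measure_eq_zero_iff_ae_notMem, measure_toMeasurable]
  rw [hπ.compProd_countKernel] at hfst
  filter_upwards [ae_of_ae_map measurable_insert_prod.aemeasurable hfst] with z hz
  exact not_not.1 fun h => hz (subset_toMeasurable _ _ h)

end IsPoisson

section WeightedZeta

variable {ι κ R : Type*} [DecidableEq ι] [DecidableEq κ]

/-- The zeta transform `S ↦ ∑_{T ⊆ S} (∏_{i ∈ S \ T} h i) g(T)` of a set function with weights
`h`. The weights `1` and `-1` give the sum over all subsets and its Möbius inverse. -/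
def weightedZeta [CommSemiring R] (h : ι → R) (g : Finset ι → R) (S : Finset ι) : R :=
  ∑ T ∈ S.powerset, (∏ i ∈ S \ T, h i) * g T

section CommSemiring

variable [CommSemiring R] (h k : ι → R) (g : Finset ι → R)

@[simp]
theorem weightedZeta_empty : weightedZeta h g ∅ = g ∅ := by simp [weightedZeta]

theorem weightedZeta_insert {i : ι} {S : Finset ι} (hi : i ∉ S) :
    weightedZeta h g (insert i S) =
      h i * weightedZeta h g S + weightedZeta h (fun T => g (insert i T)) S := by
  rw [weightedZeta, Finset.sum_powerset_insert hi, weightedZeta, Finset.mul_sum]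
  congr 1
  · refine Finset.sum_congr rfl fun T hT => ?_
    have hiT : i ∉ T := fun h => hi (Finset.mem_powerset.1 hT h)
    rw [Finset.insert_sdiff_of_notMem _ hiT, Finset.prod_insert (by simp [hi]), mul_assoc]
  · refine Finset.sum_congr rfl fun T _ => ?_
    rw [Finset.insert_sdiff_insert, Finset.sdiff_insert_of_notMem hi]

theorem weightedZeta_congr {g' : Finset ι → R} {S : Finset ι} (hg : ∀ T ⊆ S, g T = g' T) :
    weightedZeta h g S = weightedZeta h g' S :=
  Finset.sum_congr rfl fun T hT => by rw [hg T (Finset.mem_powerset.1 hT)]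

theorem weightedZeta_const_mul_add (c : R) (g' : Finset ι → R) (S : Finset ι) :
    weightedZeta h (fun T => c * g T + g' T) S = c * weightedZeta h g S + weightedZeta h g' S := by
  simp only [weightedZeta, mul_add, Finset.sum_add_distrib, Finset.mul_sum, mul_left_comm c]

theorem weightedZeta_zero (S : Finset ι) : weightedZeta 0 g S = g S := by
  induction S using Finset.induction_on generalizing g with
  | empty => exact weightedZeta_empty 0 g
  | insert i S hi ih => rw [weightedZeta_insert 0 g hi, Pi.zero_apply, zero_mul, zero_add, ih]

theorem weightedZeta_one (S : Finset ι) : weightedZeta 1 g S = ∑ T ∈ S.powerset, g T := by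
  simp [weightedZeta]

theorem weightedZeta_weightedZeta (S : Finset ι) :
    weightedZeta h (weightedZeta k g) S = weightedZeta (h + k) g S := by
  induction S using Finset.induction_on generalizing g with
  | empty => simp
  | insert i S hi ih =>
    have hk : ∀ T ⊆ S, weightedZeta k g (insert i T) =
        k i * weightedZeta k g T + weightedZeta k (fun T => g (insert i T)) T :=
      fun T hT => weightedZeta_insert k g fun h => hi (hT h)
    rw [weightedZeta_insert _ _ hi, weightedZeta_congr h _ hk, weightedZeta_const_mul_add, ih, ih,
      weightedZeta_insert _ _ hi, Pi.add_apply]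
    ring

theorem weightedZeta_map (e : κ ↪ ι) (S : Finset κ) :
    weightedZeta h g (S.map e) = weightedZeta (h ∘ e) (fun T => g (T.map e)) S := by
  induction S using Finset.induction_on generalizing g with
  | empty => simp
  | insert i S hi ih =>
    rw [Finset.map_insert, weightedZeta_insert _ _ (by simpa using hi), weightedZeta_insert _ _ hi,
      ih, ih]
    simp only [Finset.map_insert, Function.comp_apply]

end CommSemiring

theorem weightedZeta_neg_right [CommRing R] (h : ι → R) (g : Finset ι → R) (S : Finset ι) :
    weightedZeta h (weightedZeta (-h) g) S = g S := by
  rw [weightedZeta_weightedZeta, add_neg_cancel, weightedZeta_zero]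

end WeightedZeta

section Gradient

variable {X : Type*} [TopologicalSpace X]

namespace Configuration

variable {ι : Type*}

/-- The configuration `ω ∪ {s_i : i ∈ S}`. -/
def addPoints (ω : Configuration X) (s : ι → X) (S : Finset ι) : Configuration X where
  carrier := ω.carrier ∪ s '' S
  finite_inter_compact K hK := by
    rw [Set.union_inter_distrib_right]
    exact (ω.finite_inter_compact K hK).union ((S.finite_toSet.image s).inter_of_left K)

@[simp]
theorem addPoints_empty (ω : Configuration X) (s : ι → X) : ω.addPoints s ∅ = ω := by
  ext1; simp [addPoints]

theorem addPoints_insert [DecidableEq ι] (ω : Configuration X) (s : ι → X) (i : ι)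
    (S : Finset ι) : ω.addPoints s (Insert.insert i S) = (ω.addPoints s S).insert (s i) := by
  ext1
  simp only [addPoints, insert, Finset.coe_insert, Set.image_insert_eq]
  rw [Set.union_assoc, Set.union_singleton]

theorem insert_addPoints [DecidableEq ι] (ω : Configuration X) (s : ι → X) (i : ι)
    (S : Finset ι) : (ω.insert (s i)).addPoints s S = ω.addPoints s (Insert.insert i S) := by
  ext1
  simp only [addPoints, insert, Finset.coe_insert, Set.image_insert_eq]
  rw [Set.union_assoc, Set.singleton_union]

theorem addPoints_comp {κ : Type*} (ω : Configuration X) (s : ι → X) (e : κ ↪ ι)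
    (S : Finset κ) : ω.addPoints (s ∘ e) S = ω.addPoints s (S.map e) := by
  ext1
  simp [addPoints, ← Set.image_comp]

end Configuration

theorem foldr_gradD {ι : Type*} [DecidableEq ι] (s : ι → X) (F : Configuration X → ℝ)
    {L : List ι} (hL : L.Nodup) (ω : Configuration X) :
    L.foldr (fun i G => gradD (s i) G) F ω =
      weightedZeta (-1) (fun T => F (ω.addPoints s T)) L.toFinset := by
  induction L generalizing ω with
  | nil => simp
  | cons i L ih =>
    obtain ⟨hi, hL⟩ := List.nodup_cons.1 hL
    rw [List.foldr_cons, gradD, ih hL, ih hL, List.toFinset_cons,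
      weightedZeta_insert _ _ (by simpa using hi)]
    simp only [Configuration.insert_addPoints, Pi.neg_apply, Pi.one_apply, neg_one_mul,
      sub_eq_neg_add]

variable {m : ℕ} (s : Fin m → X)

theorem gradSet_eq_weightedZeta (F : Configuration X → ℝ) (ω : Configuration X)
    (S : Finset (Fin m)) :
    gradSet s S F ω = weightedZeta (-1) (fun T => F (ω.addPoints s T)) S := by
  rw [gradSet, foldr_gradD _ _ ((List.nodup_finRange m).filter _), List.toFinset_filter]
  simp

theorem sum_gradSet (F : Configuration X → ℝ) (ω : Configuration X) (S : Finset (Fin m)) :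
    ∑ T ∈ S.powerset, gradSet s T F ω = F (ω.addPoints s S) := by
  simp only [gradSet_eq_weightedZeta]
  rw [← weightedZeta_one]
  exact weightedZeta_neg_right 1 (fun T => F (ω.addPoints s T)) S

/-- The product `∏_p v_p(s_p)(ω ∪ {s_i : i ∈ S, i ≠ p})`. -/
def shiftProd {ι : Type*} [Fintype ι] [DecidableEq ι] (v : ι → Configuration X → X → ℝ)
    (S : Finset ι) (ω : Configuration X) (s : ι → X) : ℝ :=
  ∏ p, v p (ω.addPoints s (S.erase p)) (s p)

theorem shiftProd_eq_sum_gradSet (v : Fin m → Configuration X → X → ℝ) (ω : Configuration X)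
    (S : Finset (Fin m)) :
    shiftProd v S ω s = ∑ T ∈ S.powerset,
      ∑ Θ : Fin m → Finset (Fin m) with (Finset.univ.biUnion Θ = T ∧ ∀ p, p ∉ Θ p),
        ∏ p, gradSet s (Θ p) (fun η => v p η (s p)) ω := by
  have hgrad (p : Fin m) : v p (ω.addPoints s (S.erase p)) (s p) =
      ∑ T ∈ (S.erase p).powerset, gradSet s T (fun η => v p η (s p)) ω :=
    (sum_gradSet s (fun η => v p η (s p)) ω _).symm
  simp_rw [shiftProd, hgrad]
  rw [Finset.prod_univ_sum, ← Finset.sum_fiberwise_of_maps_to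
    (g := fun Θ => Finset.univ.biUnion Θ) (t := S.powerset)]
  · refine Finset.sum_congr rfl fun T hT => Finset.sum_congr ?_ fun _ _ => rfl
    rw [Finset.mem_powerset] at hT
    ext Θ
    simp only [Finset.mem_filter, Fintype.mem_piFinset, Finset.mem_powerset, Finset.mem_univ,
      true_and, Finset.subset_erase, forall_and]
    refine ⟨fun ⟨h, hΘ⟩ => ⟨hΘ, h.2⟩, fun ⟨hΘ, h⟩ => ⟨⟨fun p => ?_, h⟩, hΘ⟩⟩
    exact (Finset.subset_biUnion_of_mem Θ (Finset.mem_univ p)).trans (hΘ.trans_subset hT)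
  · intro Θ hΘ
    simp only [Fintype.mem_piFinset, Finset.mem_powerset] at hΘ
    exact Finset.mem_powerset.2 (Finset.biUnion_subset.2 fun p _ =>
      (hΘ p).trans (Finset.erase_subset _ _))

theorem bigDelta_eq_weightedZeta (v : Fin m → Configuration X → X → ℝ) (ω : Configuration X) :
    bigDelta v s ω = weightedZeta (-1) (fun S => shiftProd v S ω s) Finset.univ := by
  simp only [shiftProd_eq_sum_gradSet, ← weightedZeta_one]
  rw [weightedZeta_weightedZeta, neg_add_cancel, weightedZeta_zero]
  simp only [bigDelta]

end Gradient

section Isometry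

variable {X Y : Type*} [MeasurableSpace X] [MeasurableSpace Y] {σ : Measure X} {μ : Measure Y}

theorem eLpNorm_natCast_add_one_pow (f : X → ℝ) (n : ℕ) :
    eLpNorm f ((n : ℝ≥0∞) + 1) σ ^ (n + 1) = ∫⁻ x, ‖f x‖ₑ ^ (n + 1) ∂σ := by
  have h := eLpNorm_nnreal_pow_eq_lintegral (f := f) (μ := σ) (p := ((n + 1 : ℕ) : ℝ≥0))
    (by positivity)
  rw [NNReal.coe_natCast, ENNReal.rpow_natCast, ENNReal.coe_natCast, Nat.cast_add_one] at h
  simpa only [ENNReal.rpow_natCast] using h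

theorem lintegral_enorm_pow_lt_top {f : X → ℝ} {n : ℕ} (hf : MemLp f ((n : ℝ≥0∞) + 1) σ) :
    ∫⁻ x, ‖f x‖ₑ ^ (n + 1) ∂σ < ∞ := by
  rw [← eLpNorm_natCast_add_one_pow]
  exact ENNReal.pow_lt_top hf.2

theorem lintegral_enorm_pow_eq_enorm_pow {n : ℕ} (f : Lp ℝ ((n : ℝ≥0∞) + 1) σ) :
    ∫⁻ x, ‖f x‖ₑ ^ (n + 1) ∂σ = ‖f‖ₑ ^ (n + 1) := by
  rw [← eLpNorm_natCast_add_one_pow, Lp.enorm_def]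

theorem integrable_pow {n : ℕ} (f : Lp ℝ ((n : ℝ≥0∞) + 1) σ) :
    Integrable (fun x => f x ^ (n + 1)) σ :=
  ⟨(Lp.aestronglyMeasurable f).pow _, by
    simpa only [HasFiniteIntegral, enorm_pow] using lintegral_enorm_pow_lt_top (Lp.memLp f)⟩

theorem integral_pow_eq_norm_pow {n : ℕ} {f : Lp ℝ ((n : ℝ≥0∞) + 1) σ} (hf : 0 ≤ f) :
    ∫ x, f x ^ (n + 1) ∂σ = ‖f‖ ^ (n + 1) := by
  have hpos : 0 ≤ᵐ[σ] f := (Lp.coeFn_nonneg f).2 hf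
  rw [integral_eq_lintegral_of_nonneg_ae (hpos.mono fun x hx => pow_nonneg hx _)
      (integrable_pow f).1, ← toReal_enorm, ← ENNReal.toReal_pow,
    ← lintegral_enorm_pow_eq_enorm_pow]
  congr 1
  refine lintegral_congr_ae (hpos.mono fun x (hx : 0 ≤ f x) => ?_)
  simp only [Real.enorm_of_nonneg hx, ENNReal.ofReal_pow hx]

theorem integral_pow_eq_posPart_negPart {n : ℕ} (f : Lp ℝ ((n : ℝ≥0∞) + 1) σ) :
    ∫ x, f x ^ (n + 1) ∂σ = ‖f⁺‖ ^ (n + 1) + (-1) ^ (n + 1) * ‖f⁻‖ ^ (n + 1) := by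
  rw [← integral_pow_eq_norm_pow (posPart_nonneg f), ← integral_pow_eq_norm_pow (negPart_nonneg f),
    ← integral_const_mul, ← integral_add (integrable_pow _) ((integrable_pow _).const_mul _)]
  have hpos : ⇑f⁺ =ᵐ[σ] f ⊔ ⇑(0 : Lp ℝ ((n : ℝ≥0∞) + 1) σ) := Lp.coeFn_sup f 0
  have hneg : ⇑f⁻ =ᵐ[σ] ⇑(-f) ⊔ ⇑(0 : Lp ℝ ((n : ℝ≥0∞) + 1) σ) := Lp.coeFn_sup (-f) 0
  refine integral_congr_ae ?_
  filter_upwards [hpos, hneg, Lp.coeFn_neg f, Lp.coeFn_zero ℝ ((n : ℝ≥0∞) + 1) σ]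
    with x h₁ h₂ h₃ h₄
  rw [h₁, h₂, Pi.sup_apply, Pi.sup_apply, h₃, h₄, Pi.neg_apply, Pi.zero_apply, ← mul_pow,
    neg_one_mul]
  rcases le_total 0 (f x) with h | h <;> simp [h]

section PositiveIsometry

variable {q : ℝ≥0∞} [Fact (1 ≤ q)]

theorem eq_of_le_of_norm_le (hq : q ≠ ∞) {f g : Lp ℝ q σ} (hf : 0 ≤ f) (hfg : f ≤ g)
    (hnorm : ‖g‖ ≤ ‖f‖) : f = g := by
  have hq0 : q ≠ 0 := (zero_lt_one.trans_le Fact.out).ne'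
  have hq_pos : 0 < q.toReal := ENNReal.toReal_pos hq0 hq
  have hle : ∀ᵐ x ∂σ, ‖f x‖ₑ ^ q.toReal ≤ ‖g x‖ₑ ^ q.toReal := by
    filter_upwards [(Lp.coeFn_nonneg f).2 hf, (Lp.coeFn_le f g).2 hfg] with x h₀ h₁
    gcongr
    rw [Real.enorm_of_nonneg h₀, Real.enorm_of_nonneg (h₀.trans h₁)]
    exact ENNReal.ofReal_le_ofReal h₁
  have hint : ∫⁻ x, ‖g x‖ₑ ^ q.toReal ∂σ ≤ ∫⁻ x, ‖f x‖ₑ ^ q.toReal ∂σ := by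
    rw [← enorm_le_iff_norm_le, Lp.enorm_def, Lp.enorm_def,
      eLpNorm_eq_lintegral_rpow_enorm_toReal hq0 hq,
      eLpNorm_eq_lintegral_rpow_enorm_toReal hq0 hq] at hnorm
    exact (ENNReal.rpow_le_rpow_iff (one_div_pos.2 hq_pos)).1 hnorm
  have hae := ae_eq_of_ae_le_of_lintegral_le hle
    (lintegral_rpow_enorm_lt_top_of_eLpNorm_lt_top hq0 hq (Lp.eLpNorm_lt_top f)).ne
    ((Lp.aestronglyMeasurable g).enorm.pow_const _) hint
  refine Lp.ext ?_
  filter_upwards [hae, (Lp.coeFn_nonneg f).2 hf, (Lp.coeFn_le f g).2 hfg] with x h h₀ h₁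
  have henorm : ‖f x‖ₑ = ‖g x‖ₑ := ENNReal.rpow_left_injective hq_pos.ne' h
  rwa [Real.enorm_of_nonneg h₀, Real.enorm_of_nonneg (h₀.trans h₁),
    ENNReal.ofReal_eq_ofReal_iff h₀ (h₀.trans h₁)] at henorm

theorem map_abs_of_nonneg (hq : q ≠ ∞) (T : Lp ℝ q μ →ₗᵢ[ℝ] Lp ℝ q σ)
    (hT : ∀ f, 0 ≤ f → 0 ≤ T f) (f : Lp ℝ q μ) : T |f| = |T f| := by
  have hmono : Monotone T := fun f g hfg => by
    simpa only [map_sub, sub_nonneg] using hT (g - f) (sub_nonneg.2 hfg)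
  refine (eq_of_le_of_norm_le hq (abs_nonneg _) (abs_le'.2 ⟨hmono (le_abs_self f), ?_⟩) ?_).symm
  · simpa only [map_neg] using hmono (neg_le_abs f)
  · rw [norm_abs_eq_norm, T.norm_map, T.norm_map, norm_abs_eq_norm]

theorem map_posPart_of_nonneg (hq : q ≠ ∞) (T : Lp ℝ q μ →ₗᵢ[ℝ] Lp ℝ q σ)
    (hT : ∀ f, 0 ≤ f → 0 ≤ T f) (f : Lp ℝ q μ) : T f⁺ = (T f)⁺ := by
  have : IsAddTorsionFree (Lp ℝ q σ) := .of_module_rat _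
  refine nsmul_right_injective two_ne_zero ?_
  calc 2 • T f⁺ = T (|f| + f) := by rw [← map_nsmul, abs_add_eq_two_nsmul_posPart]
    _ = |T f| + T f := by rw [map_add, map_abs_of_nonneg hq T hT]
    _ = 2 • (T f)⁺ := abs_add_eq_two_nsmul_posPart _

theorem map_negPart_of_nonneg (hq : q ≠ ∞) (T : Lp ℝ q μ →ₗᵢ[ℝ] Lp ℝ q σ)
    (hT : ∀ f, 0 ≤ f → 0 ≤ T f) (f : Lp ℝ q μ) : T f⁻ = (T f)⁻ := by
  rw [← posPart_neg, map_posPart_of_nonneg hq T hT, map_neg, posPart_neg]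

end PositiveIsometry

theorem integral_map_pow_of_nonneg {n : ℕ}
    (T : Lp ℝ ((n : ℝ≥0∞) + 1) μ →ₗᵢ[ℝ] Lp ℝ ((n : ℝ≥0∞) + 1) σ)
    (hT : ∀ f, 0 ≤ f → 0 ≤ T f) (f : Lp ℝ ((n : ℝ≥0∞) + 1) μ) :
    ∫ x, T f x ^ (n + 1) ∂σ = ∫ y, f y ^ (n + 1) ∂μ := by
  have hq : (n : ℝ≥0∞) + 1 ≠ ∞ := by finiteness
  rw [integral_pow_eq_posPart_negPart, integral_pow_eq_posPart_negPart,
    ← map_posPart_of_nonneg hq T hT, ← map_negPart_of_nonneg hq T hT, T.norm_map, T.norm_map]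

/-- `v` has the moments `∫ v ^ k = H k`, and its absolute moments are bounded by the finite
constants `A k`, for `1 ≤ k ≤ N + 1`. -/
def HasMoments (σ : Measure X) (N : ℕ) (A : ℕ → ℝ≥0) (H : ℕ → ℝ) (v : X → ℝ) : Prop :=
  ∀ k, 1 ≤ k → k ≤ N + 1 → ∫⁻ x, ‖v x‖ₑ ^ k ∂σ ≤ A k ∧ ∫ x, v x ^ k ∂σ = H k

theorem HasMoments.integrable_pow {N : ℕ} {A : ℕ → ℝ≥0} {H : ℕ → ℝ} {v : X → ℝ}
    (hv : Measurable v) (hm : HasMoments σ N A H v) {k : ℕ} (hk : 1 ≤ k)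
    (hkN : k ≤ N + 1) : Integrable (fun x => v x ^ k) σ := by
  refine ⟨(hv.pow_const k).aestronglyMeasurable, ?_⟩
  simpa only [HasFiniteIntegral, enorm_pow] using (hm k hk hkN).1.trans_lt ENNReal.coe_lt_top

theorem IsVersion.hasMoments [TopologicalSpace X] {N : ℕ} {π : Measure (Configuration X)}
    {R : RandomIsometry N μ σ} {h : Y → ℝ}
    {hh : ∀ p : Fin (N + 1), MemLp h (((p : ℕ) : ℝ≥0∞) + 1) μ} {u : Configuration X → X → ℝ}
    (hu : IsVersion π R h hh u) :
    ∀ᵐ ω ∂π, HasMoments σ N (fun k => (∫⁻ y, ‖h y‖ₑ ^ k ∂μ).toNNReal)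
      (fun k => ∫ y, h y ^ k ∂μ) (u ω) := by
  filter_upwards [hu] with ω hω k hk hkN
  obtain ⟨p, rfl⟩ : ∃ p, k = p + 1 := ⟨k - 1, by omega⟩
  let q : Fin (N + 1) := ⟨p, by omega⟩
  have hcoe : (hh q).toLp h =ᵐ[μ] h := (hh q).coeFn_toLp
  constructor
  · rw [ENNReal.coe_toNNReal (lintegral_enorm_pow_lt_top (hh q)).ne,
      ← eLpNorm_natCast_add_one_pow, ← eLpNorm_natCast_add_one_pow, eLpNorm_congr_ae (hω q),
      ← eLpNorm_congr_ae hcoe, ← Lp.enorm_def, ← Lp.enorm_def,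
      LinearIsometry.enorm_map]
  · calc ∫ x, u ω x ^ (p + 1) ∂σ
        = ∫ x, R.toIsometry ω q ((hh q).toLp h) x ^ (p + 1) ∂σ :=
          integral_congr_ae ((hω q).pow_const _)
      _ = ∫ y, (hh q).toLp h y ^ (p + 1) ∂μ :=
          integral_map_pow_of_nonneg (R.toIsometry ω q) (R.nonneg ω q) _
      _ = ∫ y, h y ^ (p + 1) ∂μ := integral_congr_ae (hcoe.pow_const _)

end Isometry

section PiMeasure

variable {X : Type*} [MeasurableSpace X] (σ : Measure X) [SigmaFinite σ] {ι : Type*} [Fintype ι]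

theorem measurePreserving_comp_equiv {κ : Type*} [Fintype κ] (e : κ ≃ ι) :
    MeasurePreserving (fun s : ι → X => s ∘ e) (Measure.pi fun _ => σ)
      (Measure.pi fun _ => σ) := by
  convert! measurePreserving_piCongrLeft (fun _ : κ => σ) e.symm using 1
  ext s k
  obtain ⟨i, rfl⟩ := e.symm.surjective k
  rw [MeasurableEquiv.piCongrLeft_apply_apply, Function.comp_apply, e.apply_symm_apply]

theorem measurePreserving_restrict_prod [DecidableEq ι] {Ω : Type*} [MeasurableSpace Ω]
    (π : Measure Ω) [SFinite π] (S : Finset ι) :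
    MeasurePreserving (fun z : Ω × (ι → X) =>
        ((z.1, fun i : S => z.2 i), fun i : {i // i ∉ S} => z.2 i))
      (π.prod (Measure.pi fun _ => σ))
      ((π.prod (Measure.pi fun _ => σ)).prod (Measure.pi fun _ => σ)) := by
  have hsplit : MeasurePreserving
      (fun s : ι → X => ((fun i : S => s i), fun i : {i // i ∉ S} => s i))
      (Measure.pi fun _ => σ) ((Measure.pi fun _ => σ).prod (Measure.pi fun _ => σ)) := by
    convert! measurePreserving_piEquivPiSubtypeProd (fun _ : ι => σ) (· ∈ S)
  have hassoc := (measurePreserving_prodAssoc π (Measure.pi fun _ : S => σ)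
    (Measure.pi fun _ : {i // i ∉ S} => σ)).symm (e := MeasurableEquiv.prodAssoc)
  exact hassoc.comp ((MeasurePreserving.id π).prod hsplit)

theorem measurePreserving_uncons (n : ℕ) :
    MeasurePreserving (fun s : Fin (n + 1) → X => (s 0, Fin.tail s))
      (Measure.pi fun _ => σ) (σ.prod (Measure.pi fun _ => σ)) :=
  measurePreserving_piFinSuccAbove (fun _ : Fin (n + 1) => σ) 0

theorem lintegral_enorm_fintype_prod {f : ι → X → ℝ} (hf : ∀ i, Integrable (f i) σ) :
    ∫⁻ s : ι → X, ‖∏ i, f i (s i)‖ₑ ∂(Measure.pi fun _ => σ) = ∏ i, ∫⁻ x, ‖f i x‖ₑ ∂σ := by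
  have hint : Integrable (fun s : ι → X => ∏ i, f i (s i)) (Measure.pi fun _ => σ) :=
    Integrable.fintype_prod_dep hf
  rw [← ofReal_integral_norm_eq_lintegral_enorm hint]
  simp_rw [norm_prod]
  rw [integral_fintype_prod_eq_prod (fun i x => ‖f i x‖),
    ENNReal.ofReal_prod_of_nonneg fun i _ => integral_nonneg fun _ => norm_nonneg _]
  exact Finset.prod_congr rfl fun i _ => ofReal_integral_norm_eq_lintegral_enorm (hf i)

end PiMeasure

section ShiftProd

variable {X : Type*} [TopologicalSpace X] {ι : Type*} [Fintype ι] [DecidableEq ι]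

theorem insert_addPoints_tail {n : ℕ} (ω : Configuration X) (s : Fin (n + 1) → X) :
    (ω.insert (s 0)).addPoints (Fin.tail s) Finset.univ = ω.addPoints s Finset.univ := by
  ext1
  simp [addPoints, Configuration.insert, Fin.range_fin_succ s, Set.insert_union,
    Set.union_insert]

theorem shiftProd_comp_equiv {κ : Type*} [Fintype κ] [DecidableEq κ]
    (e : κ ≃ ι) (v : ι → Configuration X → X → ℝ) (ω : Configuration X) (s : ι → X) :
    shiftProd (v ∘ e) Finset.univ ω (s ∘ e) = shiftProd v Finset.univ ω s := by
  simp only [shiftProd]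
  rw [← e.prod_comp]
  refine Finset.prod_congr rfl fun p _ => ?_
  have herase := ω.addPoints_comp s e.toEmbedding (Finset.univ.erase p)
  rw [Finset.map_erase, Finset.map_univ_equiv] at herase
  exact congrArg (fun η => v (e p) η (s (e p))) herase

theorem shiftProd_eq_mul_prod_compl (S : Finset ι) (v : ι → Configuration X → X → ℝ)
    (ω : Configuration X) (s : ι → X) :
    shiftProd v S ω s = shiftProd (fun p : S => v p) Finset.univ ω (fun p : S => s p) *
      ∏ q : {q // q ∉ S}, v q (ω.addPoints (fun p : S => s p) Finset.univ) (s q) := by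
  have hmap (T : Finset S) : ω.addPoints (fun p : S => s p) T =
      ω.addPoints s (T.map (.subtype (· ∈ S))) := ω.addPoints_comp s (.subtype (· ∈ S)) T
  simp only [shiftProd, hmap, Finset.map_erase, Finset.univ_eq_attach, Finset.attach_map_val,
    Function.Embedding.subtype_apply]
  rw [← Fintype.prod_subtype_mul_prod_subtype (· ∈ S)]
  congr 1
  · exact Finset.prod_congr (by ext; simp) fun _ _ => rfl
  · exact Finset.prod_congr rfl fun q _ => by rw [Finset.erase_eq_of_notMem q.2]

theorem enorm_shiftProd_univ_le {m : ℕ} (v : Fin m → Configuration X → X → ℝ)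
    (ω : Configuration X) (s : Fin m → X) :
    ‖shiftProd v Finset.univ ω s‖ₑ ≤ ‖bigDelta v s ω‖ₑ +
      ∑ S ∈ Finset.univ.erase Finset.univ, ‖shiftProd v S ω s‖ₑ := by
  have hsub : shiftProd v Finset.univ ω s = bigDelta v s ω -
      ∑ S ∈ Finset.univ.erase Finset.univ,
        (∏ _i ∈ Finset.univ \ S, (-1 : ℝ)) * shiftProd v S ω s := by
    rw [bigDelta_eq_weightedZeta, weightedZeta, Finset.powerset_univ,
      ← Finset.add_sum_erase _ _ (Finset.mem_univ Finset.univ)]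
    simp
  rw [hsub]
  refine enorm_sub_le.trans (add_le_add le_rfl ((enorm_sum_le _ _).trans_eq ?_))
  refine Finset.sum_congr rfl fun S _ => ?_
  rw [enorm_mul, Finset.prod_const, enorm_pow, enorm_neg, enorm_one, one_pow, one_mul]

end ShiftProd

section AddPoints

variable {X : Type*} [TopologicalSpace X] [T2Space X] [SecondCountableTopology X]
  [SigmaCompactSpace X] [MeasurableSpace X] [OpensMeasurableSpace X]

namespace Configuration

theorem measurable_addPoints {Z ι : Type*} [MeasurableSpace Z] {f : Z → Configuration X}
    {g : Z → ι → X} (hf : Measurable f) (hg : Measurable g) (S : Finset ι) :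
    Measurable fun z => (f z).addPoints (g z) S := by
  classical
  induction S using Finset.induction_on with
  | empty => simpa only [addPoints_empty] using hf
  | insert i S _ ih =>
    simp only [addPoints_insert]
    exact measurable_insert ih (measurable_pi_iff.1 hg i)

end Configuration

theorem measurable_shiftProd {ι : Type*} [Fintype ι] [DecidableEq ι]
    {v : ι → Configuration X → X → ℝ} (hv : ∀ p, Measurable (Function.uncurry (v p)))
    (S : Finset ι) :
    Measurable fun z : Configuration X × (ι → X) => shiftProd v S z.1 z.2 :=
  Finset.measurable_fun_prod _ fun p _ => (hv p).comp
    ((measurable_addPoints measurable_fst measurable_snd _).prodMk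
      ((measurable_pi_apply p).comp measurable_snd))

namespace IsPoisson

variable {σ : Measure X} [SigmaFinite σ] [NullSingletonClass σ] {π : Measure (Configuration X)}

theorem quasiMeasurePreserving_insert (hπ : IsPoisson σ π) :
    Measure.QuasiMeasurePreserving (fun z : Configuration X × X => z.1.insert z.2)
      (π.prod σ) π := by
  refine ⟨measurable_insert measurable_fst measurable_snd, .mk fun E hE hE0 => ?_⟩
  rw [Measure.map_apply (measurable_insert measurable_fst measurable_snd) hE]
  exact measure_eq_zero_iff_ae_notMem.2 (hπ.ae_insert (measure_eq_zero_iff_ae_notMem.1 hE0))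

theorem quasiMeasurePreserving_addPoints_fin (hπ : IsPoisson σ π) (n : ℕ) :
    Measure.QuasiMeasurePreserving
      (fun z : Configuration X × (Fin n → X) => z.1.addPoints z.2 Finset.univ)
      (π.prod (Measure.pi fun _ => σ)) π := by
  have := hπ.isProbabilityMeasure
  induction n with
  | zero => simpa using Measure.quasiMeasurePreserving_fst
  | succ n ih =>
    have huncons := (MeasurePreserving.id π).prod (measurePreserving_uncons σ n)
    have hassoc := (measurePreserving_prodAssoc π σ (Measure.pi fun _ : Fin n => σ)).symm
      (e := MeasurableEquiv.prodAssoc)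
    have hinsert := QuasiMeasurePreserving.prodMap hπ.quasiMeasurePreserving_insert
      (MeasurePreserving.id (Measure.pi fun _ : Fin n => σ)).quasiMeasurePreserving
    convert! ih.comp (hinsert.comp (hassoc.comp huncons).quasiMeasurePreserving) using 2 with z
    exact (insert_addPoints_tail z.1 z.2).symm

theorem quasiMeasurePreserving_addPoints (hπ : IsPoisson σ π) (ι : Type*) [Fintype ι] :
    Measure.QuasiMeasurePreserving
      (fun z : Configuration X × (ι → X) => z.1.addPoints z.2 Finset.univ)
      (π.prod (Measure.pi fun _ => σ)) π := by
  have := hπ.isProbabilityMeasure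
  have e := (Fintype.equivFin ι).symm
  have hcomp := (MeasurePreserving.id π).prod (measurePreserving_comp_equiv σ e)
  convert! (hπ.quasiMeasurePreserving_addPoints_fin _).comp hcomp.quasiMeasurePreserving using 2
    with z
  simpa only [Finset.map_univ_equiv] using! (z.1.addPoints_comp z.2 e.toEmbedding .univ).symm

end IsPoisson
end AddPoints

section HasMoments

variable {X : Type*} [MeasurableSpace X] {σ : Measure X} [SigmaFinite σ] {N : ℕ} {A : ℕ → ℝ≥0}
  {H : ℕ → ℝ} {v : X → ℝ} {ι : Type*} [Fintype ι] {k : ι → ℕ}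

theorem HasMoments.lintegral_enorm_prod_pow_le (hm : HasMoments σ N A H v) (hv : Measurable v)
    (hk : ∀ i, 1 ≤ k i) (hkN : ∀ i, k i ≤ N + 1) :
    ∫⁻ s : ι → X, ‖∏ i, v (s i) ^ k i‖ₑ ∂(Measure.pi fun _ => σ) ≤
      ∏ i, (A (k i) : ℝ≥0∞) := by
  rw [lintegral_enorm_fintype_prod σ (f := fun i x => v x ^ k i)
    fun i => hm.integrable_pow hv (hk i) (hkN i)]
  simp_rw [enorm_pow]
  exact Finset.prod_le_prod' fun i _ => (hm _ (hk i) (hkN i)).1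

theorem HasMoments.integral_prod_pow (hm : HasMoments σ N A H v) (hk : ∀ i, 1 ≤ k i)
    (hkN : ∀ i, k i ≤ N + 1) :
    ∫ s : ι → X, ∏ i, v (s i) ^ k i ∂(Measure.pi fun _ => σ) = ∏ i, H (k i) := by
  rw [integral_fintype_prod_eq_prod fun i x => v x ^ k i]
  exact Finset.prod_congr rfl fun i _ => (hm _ (hk i) (hkN i)).2

end HasMoments

theorem sum_restrict_le {ι : Type*} [Fintype ι] (k : ι → ℕ) (S : Finset ι) :
    ∑ i : S, k i ≤ ∑ i, k i :=
  (Finset.sum_coe_sort S k).trans_le (Finset.sum_le_univ_sum_of_nonneg fun _ => Nat.zero_le _)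

theorem le_of_sum_le {ι : Type*} [Fintype ι] {k : ι → ℕ} {m : ℕ} (hk : ∑ i, k i ≤ m) (i : ι) :
    k i ≤ m :=
  (Finset.single_le_sum (fun _ _ => Nat.zero_le _) (Finset.mem_univ i)).trans hk

/-- The processes `u^{k_p}`. -/
abbrev powProcess {X ι : Type*} [TopologicalSpace X] (u : Configuration X → X → ℝ) (k : ι → ℕ) :
    ι → Configuration X → X → ℝ :=
  fun p η x => u η x ^ k p

section JointMoment

variable {X : Type*} [TopologicalSpace X] [MeasurableSpace X] (σ : Measure X)
  (π : Measure (Configuration X)) (u : Configuration X → X → ℝ)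
  {ι : Type*} [Fintype ι] [DecidableEq ι]

/-- The joint moment `E ∫ ∏_p u(s_p)^{k_p}(ω ∪ {s_i : i ≠ p}) σ(ds)`. -/
def jointMoment (k : ι → ℕ) : ℝ :=
  ∫ z, shiftProd (powProcess u k) Finset.univ z.1 z.2 ∂π.prod (Measure.pi fun _ => σ)

/-- The absolute joint moment `E ∫ ∏_p |u(s_p)|^{k_p}(ω ∪ {s_i : i ≠ p}) σ(ds)`. -/
def jointAbsMoment (k : ι → ℕ) : ℝ≥0∞ :=
  ∫⁻ z, ‖shiftProd (powProcess u k) Finset.univ z.1 z.2‖ₑ ∂π.prod (Measure.pi fun _ => σ)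

/-- A measurable process `u` over the Poisson measure `π` whose moments up to order `N + 1` are
deterministic and for which the integrals of `Δ_{s_0} ⋯ Δ_{s_a} ∏_p u(s_p)^{l_p}` converge
absolutely. -/
structure IsMomentProcess (N : ℕ) (A : ℕ → ℝ≥0) (H : ℕ → ℝ) : Prop where
  isPoisson : IsPoisson σ π
  measurable : Measurable (Function.uncurry u)
  hasMoments : ∀ᵐ ω ∂π, HasMoments σ N A H (u ω)
  bigDelta_lt_top : ∀ (a : ℕ) (l : Fin (a + 1) → ℕ), (∀ p, 1 ≤ l p) → ∑ p, l p ≤ N + 1 →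
      ∫⁻ ω, ∫⁻ s : Fin (a + 1) → X, ‖bigDelta (powProcess u l) s ω‖ₑ
        ∂(Measure.pi fun _ => σ) ∂π < ∞

end JointMoment

section JointMomentMeasurable

variable {X : Type*} [TopologicalSpace X] [T2Space X] [SecondCountableTopology X]
  [SigmaCompactSpace X] [MeasurableSpace X] [OpensMeasurableSpace X]
  {σ : Measure X} {π : Measure (Configuration X)}
  {u : Configuration X → X → ℝ} {ι : Type*} [Fintype ι] [DecidableEq ι]
  (hu : Measurable (Function.uncurry u))
include hu

theorem measurable_shiftProd_pow (k : ι → ℕ) (S : Finset ι) :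
    Measurable fun z : Configuration X × (ι → X) => shiftProd (powProcess u k) S z.1 z.2 :=
  measurable_shiftProd (fun p => hu.pow_const (k p)) S

theorem measurable_bigDelta_pow {m : ℕ} (k : Fin m → ℕ) :
    Measurable fun z : Configuration X × (Fin m → X) => bigDelta (powProcess u k) z.2 z.1 := by
  simp only [bigDelta_eq_weightedZeta, weightedZeta]
  exact Finset.measurable_fun_sum _ fun S _ => (measurable_shiftProd_pow hu k S).const_mul _

theorem measurable_prod_compl (k : ι → ℕ) (S : Finset ι) :
    Measurable fun z : (Configuration X × (S → X)) × ({q // q ∉ S} → X) =>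
      ∏ q : {q // q ∉ S}, u (z.1.1.addPoints z.1.2 Finset.univ) (z.2 q) ^ k q :=
  Finset.measurable_fun_prod _ fun q _ => (hu.comp
    ((measurable_addPoints measurable_fst.fst measurable_fst.snd Finset.univ).prodMk
      ((measurable_pi_apply q).comp measurable_snd))).pow_const _

variable [SigmaFinite σ] [SFinite π]

theorem jointAbsMoment_comp_equiv {κ : Type*} [Fintype κ] [DecidableEq κ] (e : κ ≃ ι)
    (k : ι → ℕ) : jointAbsMoment σ π u (k ∘ e) = jointAbsMoment σ π u k := by
  have hcomp := (MeasurePreserving.id π).prod (measurePreserving_comp_equiv σ e)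
  rw [jointAbsMoment, ← hcomp.lintegral_comp (measurable_shiftProd_pow hu _ _).enorm]
  exact lintegral_congr fun z => congrArg _ (shiftProd_comp_equiv e (powProcess u k) z.1 z.2)

theorem jointMoment_comp_equiv {κ : Type*} [Fintype κ] [DecidableEq κ] (e : κ ≃ ι)
    (k : ι → ℕ) : jointMoment σ π u (k ∘ e) = jointMoment σ π u k := by
  have hcomp := (MeasurePreserving.id π).prod (measurePreserving_comp_equiv σ e)
  rw [jointMoment, ← hcomp.map_eq, integral_map hcomp.measurable.aemeasurable
    (measurable_shiftProd_pow hu _ _).aestronglyMeasurable]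
  exact integral_congr_ae (.of_forall fun z =>
    shiftProd_comp_equiv e (powProcess u k) z.1 z.2)

end JointMomentMeasurable

namespace IsMomentProcess

variable {X : Type*} [TopologicalSpace X] [T2Space X] [SecondCountableTopology X]
  [SigmaCompactSpace X] [MeasurableSpace X] [OpensMeasurableSpace X]
  {σ : Measure X} [SigmaFinite σ] [NullSingletonClass σ] {π : Measure (Configuration X)}
  {u : Configuration X → X → ℝ} {N : ℕ} {A : ℕ → ℝ≥0} {H : ℕ → ℝ}
  {ι : Type*} [Fintype ι] [DecidableEq ι]
  (h : IsMomentProcess σ π u N A H)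
include h

omit [T2Space X] [SecondCountableTopology X] [SigmaCompactSpace X] [OpensMeasurableSpace X]
  [SigmaFinite σ] [NullSingletonClass σ] in
theorem measurable_right (ω : Configuration X) : Measurable (u ω) :=
  h.measurable.comp measurable_prodMk_left

omit [Fintype ι] [DecidableEq ι] in
theorem ae_addPoints_hasMoments (S : Finset ι) :
    ∀ᵐ z ∂π.prod (Measure.pi fun _ : S => σ),
      HasMoments σ N A H (u (z.1.addPoints z.2 Finset.univ)) :=
  (h.isPoisson.quasiMeasurePreserving_addPoints S).ae h.hasMoments

theorem lintegral_enorm_shiftProd_le {k : ι → ℕ} (hk : ∀ i, 1 ≤ k i) (hkN : ∀ i, k i ≤ N + 1)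
    (S : Finset ι) :
    ∫⁻ z, ‖shiftProd (powProcess u k) S z.1 z.2‖ₑ ∂π.prod (Measure.pi fun _ => σ) ≤
      jointAbsMoment σ π u (fun i : S => k i) * ∏ q : {q // q ∉ S}, (A (k q) : ℝ≥0∞) := by
  have := h.isPoisson.isProbabilityMeasure
  let F (w : (Configuration X × (S → X)) × ({q // q ∉ S} → X)) : ℝ≥0∞ :=
    ‖shiftProd (powProcess u fun i : S => k i) Finset.univ w.1.1 w.1.2‖ₑ *
      ‖∏ q : {q // q ∉ S}, u (w.1.1.addPoints w.1.2 Finset.univ) (w.2 q) ^ k q‖ₑ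
  have hS := (measurable_shiftProd_pow h.measurable (fun i : S => k i) Finset.univ).enorm
  have hF : Measurable F :=
    (hS.comp measurable_fst).mul (measurable_prod_compl h.measurable k S).enorm
  calc ∫⁻ z, ‖shiftProd (powProcess u k) S z.1 z.2‖ₑ ∂π.prod (Measure.pi fun _ => σ)
      = ∫⁻ z : Configuration X × (ι → X), F ((z.1, fun i : S => z.2 i),
          fun i : {i // i ∉ S} => z.2 i) ∂π.prod (Measure.pi fun _ => σ) :=
        lintegral_congr fun z => by rw [shiftProd_eq_mul_prod_compl, enorm_mul]
    _ = ∫⁻ z, ∫⁻ y, F (z, y) ∂(Measure.pi fun _ => σ) ∂π.prod (Measure.pi fun _ => σ) := by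
        rw [(measurePreserving_restrict_prod σ π S).lintegral_comp hF,
          lintegral_prod _ hF.aemeasurable]
    _ ≤ ∫⁻ z, ‖shiftProd (powProcess u fun i : S => k i) Finset.univ z.1 z.2‖ₑ *
          ∏ q : {q // q ∉ S}, (A (k q) : ℝ≥0∞) ∂π.prod (Measure.pi fun _ => σ) := by
        refine lintegral_mono_ae ?_
        filter_upwards [h.ae_addPoints_hasMoments S] with z hz
        simp only [F]
        rw [lintegral_const_mul' _ _ enorm_ne_top]
        gcongr
        exact hz.lintegral_enorm_prod_pow_le (h.measurable_right _) (fun q => hk q)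
          fun q => hkN q
    _ = jointAbsMoment σ π u (fun i : S => k i) * ∏ q : {q // q ∉ S}, (A (k q) : ℝ≥0∞) :=
        lintegral_mul_const _ hS

theorem integrable_shiftProd {k : ι → ℕ} (hk : ∀ i, 1 ≤ k i) (hkN : ∀ i, k i ≤ N + 1)
    {S : Finset ι} (hS : jointAbsMoment σ π u (fun i : S => k i) < ∞) :
    Integrable (fun z : Configuration X × (ι → X) => shiftProd (powProcess u k) S z.1 z.2)
      (π.prod (Measure.pi fun _ => σ)) :=
  ⟨(measurable_shiftProd_pow h.measurable k S).aestronglyMeasurable,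
    (h.lintegral_enorm_shiftProd_le hk hkN S).trans_lt
      (ENNReal.mul_lt_top hS (ENNReal.prod_lt_top fun _ _ => ENNReal.coe_lt_top))⟩

theorem integral_shiftProd {k : ι → ℕ} (hk : ∀ i, 1 ≤ k i) (hkN : ∀ i, k i ≤ N + 1)
    {S : Finset ι} (hS : jointAbsMoment σ π u (fun i : S => k i) < ∞) :
    ∫ z, shiftProd (powProcess u k) S z.1 z.2 ∂π.prod (Measure.pi fun _ => σ) =
      (∏ q ∈ Finset.univ \ S, H (k q)) * jointMoment σ π u (fun i : S => k i) := by
  have := h.isPoisson.isProbabilityMeasure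
  let F (w : (Configuration X × (S → X)) × ({q // q ∉ S} → X)) : ℝ :=
    shiftProd (powProcess u fun i : S => k i) Finset.univ w.1.1 w.1.2 *
      ∏ q : {q // q ∉ S}, u (w.1.1.addPoints w.1.2 Finset.univ) (w.2 q) ^ k q
  have hF : Measurable F :=
    ((measurable_shiftProd_pow h.measurable (fun i : S => k i) Finset.univ).comp
      measurable_fst).mul (measurable_prod_compl h.measurable k S)
  have hsplit := measurePreserving_restrict_prod σ π S
  have hF_eq (z : Configuration X × (ι → X)) : shiftProd (powProcess u k) S z.1 z.2 =
      F ((z.1, fun i : S => z.2 i), fun i : {i // i ∉ S} => z.2 i) :=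
    shiftProd_eq_mul_prod_compl S _ z.1 z.2
  have hint := h.integrable_shiftProd hk hkN hS
  simp_rw [hF_eq] at hint ⊢
  calc _ = ∫ z, F z ∂(π.prod (Measure.pi fun _ => σ)).prod (Measure.pi fun _ => σ) := by
        rw [← hsplit.map_eq,
          integral_map hsplit.measurable.aemeasurable hF.aestronglyMeasurable]
    _ = ∫ z, ∫ y, F (z, y) ∂(Measure.pi fun _ => σ) ∂π.prod (Measure.pi fun _ => σ) :=
        integral_prod _ ((hsplit.integrable_comp hF.aestronglyMeasurable).1 hint)
    _ = ∫ z, (∏ q ∈ Finset.univ \ S, H (k q)) *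
          shiftProd (powProcess u fun i : S => k i) Finset.univ z.1 z.2
            ∂π.prod (Measure.pi fun _ => σ) := by
        refine integral_congr_ae ?_
        filter_upwards [h.ae_addPoints_hasMoments S] with z hz
        simp only [F]
        rw [integral_const_mul, mul_comm,
          Finset.prod_subtype (Finset.univ \ S) (p := (· ∉ S)) (by simp)]
        exact congrArg (· * _) (hz.integral_prod_pow (fun q => hk q) fun q => hkN q)
    _ = (∏ q ∈ Finset.univ \ S, H (k q)) * jointMoment σ π u (fun i : S => k i) :=
        integral_const_mul _ _

theorem jointAbsMoment_lt_top_of_forall_ne_univ {a : ℕ} {k : Fin (a + 1) → ℕ} (hk : ∀ i, 1 ≤ k i)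
    (hs : ∑ i, k i ≤ N + 1)
    (hS : ∀ S : Finset (Fin (a + 1)), S ≠ Finset.univ →
      jointAbsMoment σ π u (fun i : S => k i) < ∞) :
    jointAbsMoment σ π u k < ∞ := by
  have := h.isPoisson.isProbabilityMeasure
  have hΔ := (measurable_bigDelta_pow h.measurable k).enorm
  calc jointAbsMoment σ π u k
      ≤ ∫⁻ z, ‖bigDelta (powProcess u k) z.2 z.1‖ₑ + ∑ S ∈ Finset.univ.erase Finset.univ,
          ‖shiftProd (powProcess u k) S z.1 z.2‖ₑ ∂π.prod (Measure.pi fun _ => σ) :=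
        lintegral_mono fun z => enorm_shiftProd_univ_le (powProcess u k) z.1 z.2
    _ = ∫⁻ ω, ∫⁻ s, ‖bigDelta (powProcess u k) s ω‖ₑ ∂(Measure.pi fun _ => σ) ∂π +
          ∑ S ∈ Finset.univ.erase Finset.univ,
            ∫⁻ z, ‖shiftProd (powProcess u k) S z.1 z.2‖ₑ ∂π.prod (Measure.pi fun _ => σ) := by
        rw [lintegral_add_left hΔ, lintegral_prod _ hΔ.aemeasurable,
          lintegral_finsetSum _ fun S _ => (measurable_shiftProd_pow h.measurable k S).enorm]
    _ < ∞ := ENNReal.add_lt_top.2 ⟨h.bigDelta_lt_top a k hk hs, ENNReal.sum_lt_top.2 fun S hne =>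
        (h.integrable_shiftProd hk (le_of_sum_le hs) (hS S (Finset.ne_of_mem_erase hne))).2⟩

theorem jointAbsMoment_fin_lt_top (m : ℕ) (k : Fin m → ℕ) (hk : ∀ i, 1 ≤ k i)
    (hs : ∑ i, k i ≤ N + 1) : jointAbsMoment σ π u k < ∞ := by
  have := h.isPoisson.isProbabilityMeasure
  induction m using Nat.strong_induction_on with
  | _ m ih =>
  rcases m with _ | a
  · have : IsProbabilityMeasure (Measure.pi fun _ : Fin 0 => σ) := ⟨by simp⟩
    simp [jointAbsMoment, shiftProd]
  refine h.jointAbsMoment_lt_top_of_forall_ne_univ hk hs fun S hS => ?_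
  rw [← jointAbsMoment_comp_equiv h.measurable S.equivFin.symm]
  have hcard : S.card < a + 1 := by
    simpa using Finset.card_lt_card (Finset.ssubset_univ_iff.2 hS)
  refine ih _ hcard _ (fun i => hk _) ?_
  exact (S.equivFin.symm.sum_comp fun i : S => k i).trans_le ((sum_restrict_le k S).trans hs)

theorem jointAbsMoment_lt_top (k : ι → ℕ) (hk : ∀ i, 1 ≤ k i)
    (hs : ∑ i, k i ≤ N + 1) : jointAbsMoment σ π u k < ∞ := by
  have := h.isPoisson.isProbabilityMeasure
  rw [← jointAbsMoment_comp_equiv h.measurable (Fintype.equivFin ι).symm]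
  refine h.jointAbsMoment_fin_lt_top _ _ (fun i => hk _) ?_
  exact ((Fintype.equivFin ι).symm.sum_comp k).trans_le hs

theorem integral_bigDelta {m : ℕ} (k : Fin m → ℕ) (hk : ∀ i, 1 ≤ k i)
    (hs : ∑ i, k i ≤ N + 1) :
    ∫ ω, ∫ s : Fin m → X, bigDelta (powProcess u k) s ω ∂(Measure.pi fun _ => σ) ∂π =
      weightedZeta (fun i => -H (k i)) (fun S => jointMoment σ π u (fun i : S => k i))
        Finset.univ := by
  have := h.isPoisson.isProbabilityMeasure
  have hfin (S : Finset (Fin m)) : jointAbsMoment σ π u (fun i : S => k i) < ∞ :=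
    h.jointAbsMoment_lt_top _ (fun i => hk _) ((sum_restrict_le k S).trans hs)
  have hint : ∀ S ∈ Finset.univ.powerset, Integrable
      (fun z : Configuration X × (Fin m → X) => (∏ _i ∈ Finset.univ \ S, (-1 : ℝ)) *
        shiftProd (powProcess u k) S z.1 z.2) (π.prod (Measure.pi fun _ => σ)) :=
    fun S _ => (h.integrable_shiftProd hk (le_of_sum_le hs) (hfin S)).const_mul _
  simp only [bigDelta_eq_weightedZeta, weightedZeta]
  refine (integral_prod _ (integrable_finsetSum _ hint)).symm.trans ?_
  rw [integral_finsetSum _ hint]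
  refine Finset.sum_congr rfl fun S _ => ?_
  rw [integral_const_mul, h.integral_shiftProd hk (le_of_sum_le hs) (hfin S), ← mul_assoc,
    ← Finset.prod_mul_distrib]
  simp only [neg_one_mul]

end IsMomentProcess

section ShiftedIntegral

variable {X : Type*} [TopologicalSpace X]

namespace Configuration

theorem erase_addPoints {ι : Type*} {ω : Configuration X} {t : X} {s : ι → X} {S : Finset ι}
    (h : ∀ i ∈ S, s i ≠ t) : (ω.erase t).addPoints s S = (ω.addPoints s S).erase t := by
  ext1
  simp only [addPoints, erase, Set.union_sdiff_distrib]
  rw [Set.sdiff_singleton_eq_self (s := s '' _)]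
  rintro ⟨i, hi, rfl⟩
  exact h i hi rfl

variable [MeasurableSpace X] [SigmaCompactSpace X] [T2Space X] [SecondCountableTopology X]
  [OpensMeasurableSpace X]

theorem measurableSet_mem_carrier :
    MeasurableSet {z : Configuration X × X | z.2 ∈ z.1.carrier} := by
  have hs : MeasurableSet {z : (Configuration X × X) × X | z.2 = z.1.2} :=
    measurableSet_eq_fun measurable_snd measurable_fst.snd
  have hcount : Measurable fun z : Configuration X × X => z.1.toMeasure {z.2} := by
    simpa only [Kernel.prodMkRight_apply, countKernel_apply] using!
      Kernel.measurable_kernel_prodMk_left (κ := (countKernel X).prodMkRight X) hs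
  have hmem (z : Configuration X × X) : z.2 ∉ z.1.carrier ↔ z.1.toMeasure {z.2} = 0 := by
    rw [measure_eq_zero_iff_ae_notMem, ae_toMeasure_iff]
    exact ⟨fun h y hy hyz => h (hyz ▸ hy), fun h hz => h _ hz rfl⟩
  refine MeasurableSet.of_compl ?_
  simpa only [Set.compl_ofPred, hmem] using! hcount (measurableSet_singleton 0)

theorem ae_forall_notMem_carrier {ι : Type*} [Fintype ι] (π : Measure (Configuration X))
    [SFinite π] (σ : Measure X) [SigmaFinite σ] [NullSingletonClass σ] :
    ∀ᵐ z ∂π.prod (Measure.pi fun _ : ι => σ), ∀ i, z.2 i ∉ z.1.carrier := by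
  refine ae_all_iff.2 fun i => ?_
  have hmem : ∀ᵐ z ∂π.prod σ, z.2 ∉ z.1.carrier :=
    (Measure.ae_prod_iff_ae_ae measurableSet_mem_carrier.compl).2
      (.of_forall (ae_notMem_carrier σ))
  exact (QuasiMeasurePreserving.prodMap (Measure.QuasiMeasurePreserving.id π)
    (Measure.quasiMeasurePreserving_eval (fun _ : ι => σ) i)).ae hmem

end Configuration

theorem shiftProd_fin_cons {n : ℕ} (u : Configuration X → X → ℝ) (j : ℕ) (k : Fin n → ℕ)
    (ω : Configuration X) (s : Fin (n + 1) → X) :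
    shiftProd (powProcess u (Fin.cons j k : Fin (n + 1) → ℕ)) Finset.univ ω s =
      u (ω.addPoints (Fin.tail s) Finset.univ) (s 0) ^ j *
        shiftProd (powProcess u k) Finset.univ (ω.insert (s 0)) (Fin.tail s) := by
  have htail (η : Configuration X) (S : Finset (Fin n)) :
      η.addPoints (Fin.tail s) S = η.addPoints s (S.map (Fin.succEmb n)) :=
    η.addPoints_comp s (Fin.succEmb n) S
  have herase (q : Fin n) : Finset.univ.erase q.succ =
      Insert.insert 0 ((Finset.univ.erase q).map (Fin.succEmb n)) := by
    ext i; cases i using Fin.cases <;> simp [(Fin.succ_ne_zero q).symm]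
  have herase₀ : (Finset.univ.erase 0 : Finset (Fin (n + 1))) =
      Finset.univ.map (Fin.succEmb n) := by
    ext i; cases i using Fin.cases <;> simp
  simp only [shiftProd, powProcess, Fin.prod_univ_succ, Fin.cons_zero, Fin.cons_succ, herase,
    herase₀, htail, insert_addPoints, Fin.tail]

/-- The integral `∫ u_t((ω \ {t}) ∪ {s_i : i ∈ ι}) ω(dt)`. -/
def shiftedIntegral [MeasurableSpace X] {ι : Type*} [Fintype ι] (u : Configuration X → X → ℝ)
    (ω : Configuration X) (s : ι → X) : ℝ :=
  ∫ t, u ((ω.erase t).addPoints s Finset.univ) t ∂ω.toMeasure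

variable [MeasurableSpace X] [SigmaCompactSpace X] [T2Space X] [SecondCountableTopology X]
  [OpensMeasurableSpace X] {u : Configuration X → X → ℝ} (hu : Measurable (Function.uncurry u))
include hu

theorem measurable_shiftedIntegral_integrand (ι : Type*) [Fintype ι] :
    Measurable fun z : (Configuration X × (ι → X)) × X =>
      u ((z.1.1.erase z.2).addPoints z.1.2 Finset.univ) z.2 :=
  hu.comp ((measurable_addPoints (measurable_erase measurable_fst.fst measurable_snd)
    measurable_fst.snd _).prodMk measurable_snd)

theorem measurable_shiftedIntegral (ι : Type*) [Fintype ι] :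
    Measurable fun z : Configuration X × (ι → X) => shiftedIntegral u z.1 z.2 :=
  (StronglyMeasurable.integral_kernel_prod_right
    (κ := (countKernel X).prodMkRight (ι → X))
    (f := fun z t => u ((z.1.erase t).addPoints z.2 Finset.univ) t)
    (measurable_shiftedIntegral_integrand hu ι).stronglyMeasurable).measurable

theorem measurable_integral_erase :
    Measurable fun ω : Configuration X => ∫ t, u (ω.erase t) t ∂ω.toMeasure := by
  simpa only [shiftedIntegral, Finset.univ_eq_empty, addPoints_empty, Function.comp_def] using
    (measurable_shiftedIntegral hu (Fin 0)).comp
      (measurable_prodMk_right (y := (Fin.elim0 : Fin 0 → X)))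

theorem shiftedIntegral_insert {n : ℕ} {ω : Configuration X} {s : Fin (n + 1) → X}
    (hs : s 0 ∉ ω.carrier)
    (hfin : ∫⁻ t, ‖u ((ω.erase t).addPoints s Finset.univ) t‖ₑ ∂ω.toMeasure < ∞) :
    shiftedIntegral u (ω.insert (s 0)) (Fin.tail s) =
      u (ω.addPoints (Fin.tail s) Finset.univ) (s 0) + shiftedIntegral u ω s := by
  have hint : Integrable (fun t => u ((ω.erase t).addPoints s Finset.univ) t) ω.toMeasure :=
    ⟨((measurable_shiftedIntegral_integrand hu (Fin (n + 1))).comp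
      (measurable_prodMk_left (x := (ω, s)))).aestronglyMeasurable, hfin⟩
  have hae : (fun t => u ((ω.erase t).addPoints s Finset.univ) t) =ᵐ[ω.toMeasure]
      fun t => u (((ω.insert (s 0)).erase t).addPoints (Fin.tail s) Finset.univ) t := by
    refine (ae_toMeasure_iff ω).2 fun t ht => ?_
    have herase : (ω.insert (s 0)).erase t = (ω.erase t).insert (s 0) := by
      have hne : t ≠ s 0 := fun h => hs (h ▸ ht)
      ext1
      simp only [Configuration.insert, Configuration.erase, Set.union_sdiff_distrib]
      rw [Set.sdiff_singleton_eq_self (s := {s 0}) hne]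
    simp only [herase, insert_addPoints_tail]
  rw [shiftedIntegral, toMeasure_insert hs, integral_add_measure (hint.congr hae)
    (integrable_dirac enorm_lt_top), integral_dirac, erase_insert hs, add_comm, shiftedIntegral,
    integral_congr_ae hae]

end ShiftedIntegral

section MixedMoment

/-- The mixed moment
`E ∫ ∏_p u(s_p)^{k_p}(ω ∪ {s_q : q ≠ p}) (∫ u_t((ω \ {t}) ∪ {s_q}) ω(dt))^i σ(ds)`. -/
def mixedMoment {X : Type*} [TopologicalSpace X] [MeasurableSpace X] (σ : Measure X)
    (π : Measure (Configuration X)) (u : Configuration X → X → ℝ) {n : ℕ} (k : Fin n → ℕ)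
    (i : ℕ) : ℝ :=
  ∫ z, shiftProd (powProcess u k) Finset.univ z.1 z.2 * shiftedIntegral u z.1 z.2 ^ i
    ∂π.prod (Measure.pi fun _ => σ)

theorem mixedMoment_zero {X : Type*} [TopologicalSpace X] [MeasurableSpace X] (σ : Measure X)
    (π : Measure (Configuration X)) (u : Configuration X → X → ℝ) {n : ℕ} (k : Fin n → ℕ) :
    mixedMoment σ π u k 0 = jointMoment σ π u k := by
  simp only [mixedMoment, jointMoment, pow_zero, mul_one]

variable {X : Type*} [TopologicalSpace X] [T2Space X] [SecondCountableTopology X]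
  [SigmaCompactSpace X] [MeasurableSpace X] [OpensMeasurableSpace X]
  {σ : Measure X} [SigmaFinite σ] [NullSingletonClass σ] {π : Measure (Configuration X)}

theorem IsPoisson.measurePreserving_insert_uncons (hπ : IsPoisson σ π) (n : ℕ) :
    MeasurePreserving (fun z : Configuration X × (Fin (n + 1) → X) =>
        ((z.1.insert (z.2 0), Fin.tail z.2), z.2 0))
      (π.prod (Measure.pi fun _ => σ))
      ((π.prod (Measure.pi fun _ => σ)).compProd ((countKernel X).prodMkRight (Fin n → X))) := by
  have := hπ.isProbabilityMeasure
  have hins : Measurable fun z : (Configuration X × (Fin n → X)) × X =>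
      ((z.1.1.insert z.2, z.1.2), z.2) :=
    ((measurable_insert measurable_fst.fst measurable_snd).prodMk
      measurable_fst.snd).prodMk measurable_snd
  have hinsert : MeasurePreserving (fun z : (Configuration X × (Fin n → X)) × X =>
      ((z.1.1.insert z.2, z.1.2), z.2)) ((π.prod (Measure.pi fun _ => σ)).prod σ)
      ((π.prod (Measure.pi fun _ => σ)).compProd ((countKernel X).prodMkRight (Fin n → X))) :=
    ⟨hins, (hπ.prod_compProd_countKernel _).symm⟩
  have huncons := (MeasurePreserving.id π).prod
    (Measure.measurePreserving_swap.comp (measurePreserving_uncons σ n))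
  have hassoc := (measurePreserving_prodAssoc π (Measure.pi fun _ : Fin n => σ) σ).symm
    (e := MeasurableEquiv.prodAssoc)
  exact hinsert.comp (hassoc.comp huncons)

namespace IsMomentProcess

variable {u : Configuration X → X → ℝ} {N : ℕ} {A : ℕ → ℝ≥0} {H : ℕ → ℝ}
  (h : IsMomentProcess σ π u N A H)
include h

theorem ae_lintegral_erase_lt_top :
    ∀ᵐ ω ∂π, ∫⁻ t, ‖u (ω.erase t) t‖ₑ ∂ω.toMeasure < ∞ := by
  have := h.isPoisson.isProbabilityMeasure
  have hm : Measurable fun z : Configuration X × X => ‖u (z.1.erase z.2) z.2‖ₑ :=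
    (h.measurable.comp
      ((measurable_erase measurable_fst measurable_snd).prodMk measurable_snd)).enorm
  refine ae_lt_top (hm.lintegral_kernel_prod_right' (κ := countKernel X)) (ne_of_lt ?_)
  calc ∫⁻ ω, ∫⁻ t, ‖u (ω.erase t) t‖ₑ ∂ω.toMeasure ∂π
      = ∫⁻ ω, ∫⁻ t, ‖u ((ω.insert t).erase t) t‖ₑ ∂σ ∂π :=
        h.isPoisson.lintegral_lintegral_toMeasure hm
    _ ≤ ∫⁻ _, A 1 ∂π := by
        refine lintegral_mono_ae ?_
        filter_upwards [h.hasMoments] with ω hω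
        refine (lintegral_congr_ae ?_).trans_le (hω 1 le_rfl (by omega)).1
        filter_upwards [ae_notMem_carrier σ ω] with t ht
        rw [erase_insert ht, pow_one]
    _ < ∞ := by simp

theorem ae_lintegral_addPoints_lt_top (ι : Type*) [Fintype ι] :
    ∀ᵐ z ∂π.prod (Measure.pi fun _ : ι => σ),
      ∫⁻ t, ‖u ((z.1.erase t).addPoints z.2 Finset.univ) t‖ₑ ∂z.1.toMeasure < ∞ := by
  have := h.isPoisson.isProbabilityMeasure
  filter_upwards [(h.isPoisson.quasiMeasurePreserving_addPoints ι).ae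
    h.ae_lintegral_erase_lt_top, ae_forall_notMem_carrier π σ] with z hz hmem
  refine lt_of_le_of_lt ?_ hz
  rw [lintegral_toMeasure, lintegral_toMeasure]
  have herase (t : z.1.carrier) : (z.1.erase t).addPoints z.2 Finset.univ =
      (z.1.addPoints z.2 Finset.univ).erase t :=
    erase_addPoints fun i _ hi => hmem i (hi ▸ t.2)
  simp_rw [herase]
  exact ENNReal.tsum_mono_subtype (fun t => ‖u ((z.1.addPoints z.2 Finset.univ).erase t) t‖ₑ)
    Set.subset_union_left

omit [SigmaFinite σ] [NullSingletonClass σ] in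
theorem measurable_mixedMoment_integrand {n : ℕ} (k : Fin n → ℕ) (i : ℕ) :
    Measurable fun z : Configuration X × (Fin n → X) =>
      shiftProd (powProcess u k) Finset.univ z.1 z.2 * shiftedIntegral u z.1 z.2 ^ i :=
  (measurable_shiftProd_pow h.measurable k Finset.univ).mul
    ((measurable_shiftedIntegral h.measurable (Fin n)).pow_const i)

theorem ae_shiftProd_mul_shiftedIntegral_insert {n : ℕ} (k : Fin n → ℕ) (i : ℕ) :
    ∀ᵐ z ∂π.prod (Measure.pi fun _ : Fin (n + 1) => σ),
      shiftProd (powProcess u k) Finset.univ (z.1.insert (z.2 0)) (Fin.tail z.2) *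
        shiftedIntegral u (z.1.insert (z.2 0)) (Fin.tail z.2) ^ i *
        u (((z.1.insert (z.2 0)).erase (z.2 0)).addPoints (Fin.tail z.2) Finset.univ) (z.2 0) =
      ∑ r ∈ Finset.range (i + 1), (i.choose r : ℝ) *
        (shiftProd (powProcess u (Fin.cons (r + 1) k : Fin (n + 1) → ℕ)) Finset.univ z.1 z.2 *
          shiftedIntegral u z.1 z.2 ^ (i - r)) := by
  have := h.isPoisson.isProbabilityMeasure
  filter_upwards [ae_forall_notMem_carrier π σ, h.ae_lintegral_addPoints_lt_top (Fin (n + 1))]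
    with z hmem hfin
  rw [shiftedIntegral_insert h.measurable (hmem 0) hfin, erase_insert (hmem 0), add_pow,
    Finset.mul_sum, Finset.sum_mul]
  refine Finset.sum_congr rfl fun r _ => ?_
  rw [shiftProd_fin_cons, pow_succ]
  ring

theorem integrable_and_mixedMoment_succ {n : ℕ} (k : Fin n → ℕ) (i : ℕ)
    (hI : ∀ r ∈ Finset.range (i + 1), Integrable (fun z : Configuration X × (Fin (n + 1) → X) =>
      shiftProd (powProcess u (Fin.cons (r + 1) k : Fin (n + 1) → ℕ)) Finset.univ z.1 z.2 *
        shiftedIntegral u z.1 z.2 ^ (i - r)) (π.prod (Measure.pi fun _ => σ))) :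
    Integrable (fun z : Configuration X × (Fin n → X) =>
      shiftProd (powProcess u k) Finset.univ z.1 z.2 * shiftedIntegral u z.1 z.2 ^ (i + 1))
      (π.prod (Measure.pi fun _ => σ)) ∧
    mixedMoment σ π u k (i + 1) = ∑ r ∈ Finset.range (i + 1), (i.choose r : ℝ) *
      mixedMoment σ π u (Fin.cons (r + 1) k : Fin (n + 1) → ℕ) (i - r) := by
  have := h.isPoisson.isProbabilityMeasure
  let F (w : (Configuration X × (Fin n → X)) × X) : ℝ :=
    shiftProd (powProcess u k) Finset.univ w.1.1 w.1.2 * shiftedIntegral u w.1.1 w.1.2 ^ i *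
      u ((w.1.1.erase w.2).addPoints w.1.2 Finset.univ) w.2
  have hF : Measurable F := ((h.measurable_mixedMoment_integrand k i).comp measurable_fst).mul
    (measurable_shiftedIntegral_integrand h.measurable (Fin n))
  have hT := h.isPoisson.measurePreserving_insert_uncons n
  have hae := h.ae_shiftProd_mul_shiftedIntegral_insert k i
  have hG := fun r (hr : r ∈ Finset.range (i + 1)) => (hI r hr).const_mul (i.choose r : ℝ)
  have hint : Integrable F ((π.prod (Measure.pi fun _ => σ)).compProd
      ((countKernel X).prodMkRight (Fin n → X))) :=
    (hT.integrable_comp hF.aestronglyMeasurable).1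
      ((integrable_finsetSum _ hG).congr (hae.mono fun _ hz => hz.symm))
  have hfiber (z : Configuration X × (Fin n → X)) : ∫ t, F (z, t) ∂z.1.toMeasure =
      shiftProd (powProcess u k) Finset.univ z.1 z.2 * shiftedIntegral u z.1 z.2 ^ (i + 1) := by
    simp only [F]
    rw [integral_const_mul, pow_succ, ← mul_assoc, shiftedIntegral]
  constructor
  · simpa only [Kernel.prodMkRight_apply, Kernel.prodMkLeft_apply, Kernel.const_apply,
      countKernel_apply, hfiber] using Integrable.integral_compProd (a := ())
        (κ := Kernel.const Unit (π.prod (Measure.pi fun _ => σ)))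
        (η := Kernel.prodMkLeft Unit ((countKernel X).prodMkRight (Fin n → X))) hint
  · calc mixedMoment σ π u k (i + 1)
        = ∫ z, F z ∂(π.prod (Measure.pi fun _ => σ)).compProd
            ((countKernel X).prodMkRight (Fin n → X)) := by
          rw [Measure.integral_compProd hint]
          simp only [Kernel.prodMkRight_apply, countKernel_apply, hfiber, mixedMoment]
      _ = _ := by
          rw [← hT.map_eq, integral_map hT.measurable.aemeasurable hF.aestronglyMeasurable,
            integral_congr_ae hae, integral_finsetSum _ hG]
          simp only [integral_const_mul, mixedMoment]

theorem integrable_mixedMoment (i : ℕ) {n : ℕ} (k : Fin n → ℕ) (hk : ∀ p, 1 ≤ k p)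
    (hs : ∑ p, k p + i ≤ N + 1) :
    Integrable (fun z : Configuration X × (Fin n → X) =>
      shiftProd (powProcess u k) Finset.univ z.1 z.2 * shiftedIntegral u z.1 z.2 ^ i)
      (π.prod (Measure.pi fun _ => σ)) := by
  induction i using Nat.strong_induction_on generalizing n with
  | _ i ih =>
  rcases i with _ | i
  · simp only [pow_zero, mul_one]
    exact ⟨(measurable_shiftProd_pow h.measurable k _).aestronglyMeasurable,
      h.jointAbsMoment_lt_top k hk hs⟩
  · refine (h.integrable_and_mixedMoment_succ k i fun r hr => ?_).1
    rw [Finset.mem_range] at hr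
    refine ih (i - r) (by omega) _ (Fin.cases (by simp) fun p => by simpa using hk p) ?_
    rw [Fin.sum_cons]
    omega

theorem mixedMoment_succ {n : ℕ} (k : Fin n → ℕ) (i : ℕ) (hk : ∀ p, 1 ≤ k p)
    (hs : ∑ p, k p + (i + 1) ≤ N + 1) :
    mixedMoment σ π u k (i + 1) = ∑ r ∈ Finset.range (i + 1), (i.choose r : ℝ) *
      mixedMoment σ π u (Fin.cons (r + 1) k : Fin (n + 1) → ℕ) (i - r) := by
  refine (h.integrable_and_mixedMoment_succ k i fun r hr => ?_).2
  rw [Finset.mem_range] at hr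
  refine h.integrable_mixedMoment (i - r) _ (Fin.cases (by simp) fun p => by simpa using hk p) ?_
  rw [Fin.sum_cons]
  omega

end IsMomentProcess

end MixedMoment

section Tuples

open Finset.Nat (antidiagonalTuple mem_antidiagonalTuple)

theorem sum_antidiagonalTuple_succ {M : Type*} [AddCommMonoid M] (a n : ℕ)
    (f : (Fin (a + 1) → ℕ) → M) :
    ∑ l ∈ antidiagonalTuple (a + 1) n, f l =
      ∑ r ∈ Finset.range (n + 1), ∑ l ∈ antidiagonalTuple a (n - r), f (Fin.cons r l) := by
  rw [Finset.sum_sigma']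
  refine Finset.sum_bij' (fun l _ => ⟨l 0, Fin.tail l⟩) (fun x _ => Fin.cons x.1 x.2)
    (fun l hl => ?_) (fun x hx => ?_) (fun l _ => Fin.cons_self_tail l) (fun x _ => by simp)
    (fun l _ => by rw [Fin.cons_self_tail])
  · rw [mem_antidiagonalTuple, Fin.sum_univ_succ] at hl
    simp only [Finset.mem_sigma, Finset.mem_range, mem_antidiagonalTuple, Fin.tail]
    omega
  · simp only [Finset.mem_sigma, Finset.mem_range, mem_antidiagonalTuple] at hx
    rw [mem_antidiagonalTuple, Fin.sum_cons]
    omega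

theorem sum_antidiagonalTuple_comp_perm {M : Type*} [AddCommMonoid M] {a : ℕ} (n : ℕ)
    (e : Equiv.Perm (Fin a)) (f : (Fin a → ℕ) → M) :
    ∑ l ∈ antidiagonalTuple a n, f (l ∘ e) = ∑ l ∈ antidiagonalTuple a n, f l := by
  refine Finset.sum_equiv (e.symm.arrowCongr (Equiv.refl ℕ)) (fun l => ?_) fun l _ => rfl
  rw [mem_antidiagonalTuple, mem_antidiagonalTuple, ← Equiv.sum_comp e l]
  rfl

theorem mul_sum_antidiagonalTuple_of_symmetric {a n : ℕ} (F : (Fin (a + 1) → ℕ) → ℝ)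
    (hF : ∀ (e : Equiv.Perm (Fin (a + 1))) l, F (l ∘ e) = F l) :
    ((n + a + 1 : ℕ) : ℝ) * ∑ l ∈ antidiagonalTuple (a + 1) n, F l =
      ((a + 1 : ℕ) : ℝ) * ∑ l ∈ antidiagonalTuple (a + 1) n, ((l 0 + 1 : ℕ) : ℝ) * F l := by
  have hsum : ∀ l ∈ antidiagonalTuple (a + 1) n, ((n + a + 1 : ℕ) : ℝ) * F l =
      ∑ p, ((l p + 1 : ℕ) : ℝ) * F l := by
    intro l hl
    rw [mem_antidiagonalTuple] at hl
    rw [← Finset.sum_mul, ← Nat.cast_sum, Finset.sum_add_distrib, hl]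
    simp [add_assoc]
  have hswap (p : Fin (a + 1)) :
      ∑ l ∈ antidiagonalTuple (a + 1) n, ((l p + 1 : ℕ) : ℝ) * F l =
        ∑ l ∈ antidiagonalTuple (a + 1) n, ((l 0 + 1 : ℕ) : ℝ) * F l := by
    rw [← sum_antidiagonalTuple_comp_perm n (Equiv.swap 0 p)
      (fun l => ((l 0 + 1 : ℕ) : ℝ) * F l)]
    refine Finset.sum_congr rfl fun l _ => ?_
    rw [hF, Function.comp_apply, Equiv.swap_apply_left]
  rw [Finset.mul_sum, Finset.sum_congr rfl hsum, Finset.sum_comm,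
    Finset.sum_congr rfl fun p _ => hswap p, Finset.sum_const, Finset.card_fin, nsmul_eq_mul]

/-- The multiset `{1 + l_1, …, 1 + l_a}` of the sizes of the blocks described by `l`. -/
def succMultiset {a : ℕ} (l : Fin a → ℕ) : Multiset ℕ := Finset.univ.val.map fun p => 1 + l p

theorem succMultiset_cons {a : ℕ} (r : ℕ) (l : Fin a → ℕ) :
    succMultiset (Fin.cons r l : Fin (a + 1) → ℕ) = (1 + r) ::ₘ succMultiset l := by
  simp [succMultiset, Fin.univ_val_map, List.ofFn_succ]

theorem succMultiset_comp_perm {a : ℕ} (l : Fin a → ℕ) (e : Equiv.Perm (Fin a)) :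
    succMultiset (l ∘ e) = succMultiset l := by
  conv_rhs => rw [succMultiset, ← Multiset.map_univ_val_equiv e, Multiset.map_map]
  rfl

/-- The weight `1 / (a! ∏_p (1 + l_p)!)`; multiplied by `i!` it is the number of partitions of `i`
elements into blocks of sizes `1 + l_1, …, 1 + l_a`, averaged over the orderings of the blocks. -/
def blockWeight {a : ℕ} (l : Fin a → ℕ) : ℝ :=
  ((a ! : ℝ) * ∏ p, ((1 + l p)! : ℝ))⁻¹

theorem blockWeight_comp_perm {a : ℕ} (l : Fin a → ℕ) (e : Equiv.Perm (Fin a)) :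
    blockWeight (l ∘ e) = blockWeight l := by
  rw [blockWeight, blockWeight, ← Equiv.prod_comp e fun p => ((1 + l p)! : ℝ)]
  rfl

theorem mul_blockWeight_cons {a : ℕ} (r : ℕ) (l : Fin a → ℕ) :
    ((a + 1 : ℕ) : ℝ) * (((r + 1 : ℕ) : ℝ) * blockWeight (Fin.cons r l : Fin (a + 1) → ℕ)) =
      (r ! : ℝ)⁻¹ * blockWeight l := by
  have hprod : ∏ p, ((1 + l p)! : ℝ) ≠ 0 := Finset.prod_ne_zero_iff.2 fun p _ => by positivity
  rw [blockWeight, blockWeight, Fin.prod_univ_succ]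
  simp only [Fin.cons_zero, Fin.cons_succ]
  rw [add_comm 1 r, Nat.factorial_succ r, Nat.factorial_succ a]
  push_cast
  field_simp

theorem sum_blockWeight_mul_succMultiset (a m : ℕ) (Ψ : Multiset ℕ → ℝ) :
    ((m + a + 1 : ℕ) : ℝ) *
        ∑ l ∈ antidiagonalTuple (a + 1) m, blockWeight l * Ψ (succMultiset l) =
      ∑ r ∈ Finset.range (m + 1), (r ! : ℝ)⁻¹ *
        ∑ l ∈ antidiagonalTuple a (m - r), blockWeight l * Ψ ((r + 1) ::ₘ succMultiset l) := by
  rw [mul_sum_antidiagonalTuple_of_symmetric _ fun e l => by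
    rw [blockWeight_comp_perm, succMultiset_comp_perm], sum_antidiagonalTuple_succ, Finset.mul_sum]
  refine Finset.sum_congr rfl fun r _ => ?_
  rw [Finset.mul_sum, Finset.mul_sum]
  refine Finset.sum_congr rfl fun l _ => ?_
  rw [succMultiset_cons, Fin.cons_zero, add_comm 1 r]
  linear_combination Ψ ((r + 1) ::ₘ succMultiset l) * mul_blockWeight_cons r l

/-- The sum over the partitions of `i` elements of a function `Ψ` of the multiset of block sizes,
grouped by the number `a` of blocks and their sizes `1 + l_1, …, 1 + l_a`. -/
def partitionSum (Ψ : Multiset ℕ → ℝ) (i : ℕ) : ℝ :=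
  (i ! : ℝ) * ∑ a ∈ Finset.range (i + 1), ∑ l ∈ antidiagonalTuple a (i - a),
    blockWeight l * Ψ (succMultiset l)

theorem partitionSum_zero (Ψ : Multiset ℕ → ℝ) : partitionSum Ψ 0 = Ψ 0 := by
  simp [partitionSum, blockWeight, succMultiset]

-- Here `r + 1` is the size of the block of a distinguished element.
theorem partitionSum_succ (Ψ : Multiset ℕ → ℝ) (i : ℕ) :
    partitionSum Ψ (i + 1) = ∑ r ∈ Finset.range (i + 1),
      (i.choose r : ℝ) * partitionSum (fun m => Ψ ((r + 1) ::ₘ m)) (i - r) := by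
  have hterm (r : ℕ) (hr : r ∈ Finset.range (i + 1)) :
      (i.choose r : ℝ) * partitionSum (fun m => Ψ ((r + 1) ::ₘ m)) (i - r) =
        (i ! : ℝ) * ((r ! : ℝ)⁻¹ * ∑ a ∈ Finset.range (i - r + 1),
          ∑ l ∈ antidiagonalTuple a (i - r - a),
            blockWeight l * Ψ ((r + 1) ::ₘ succMultiset l)) := by
    have hfactorial : (i.choose r : ℝ) * ((i - r)! : ℝ) = (i ! : ℝ) * (r ! : ℝ)⁻¹ := by
      rw [eq_mul_inv_iff_mul_eq₀ (by positivity), mul_right_comm]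
      exact_mod_cast Nat.choose_mul_factorial_mul_factorial (Finset.mem_range_succ_iff.1 hr)
    rw [partitionSum, ← mul_assoc, hfactorial, mul_assoc]
  have hblocks (a : ℕ) (ha : a ∈ Finset.range (i + 1)) :
      ((i + 1 : ℕ) : ℝ) * ∑ l ∈ antidiagonalTuple (a + 1) (i + 1 - (a + 1)),
        blockWeight l * Ψ (succMultiset l) =
      ∑ r ∈ Finset.range (i - a + 1), (r ! : ℝ)⁻¹ * ∑ l ∈ antidiagonalTuple a (i - r - a),
        blockWeight l * Ψ ((r + 1) ::ₘ succMultiset l) := by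
    have hle := Finset.mem_range_succ_iff.1 ha
    simpa only [Nat.sub_add_cancel hle, Nat.add_sub_add_right, Nat.sub_right_comm] using
      sum_blockWeight_mul_succMultiset a (i - a) Ψ
  rw [Finset.sum_congr rfl hterm, ← Finset.mul_sum, partitionSum, Finset.sum_range_succ',
    Nat.factorial_succ, Nat.mul_comm, Nat.cast_mul, mul_assoc, Nat.sub_zero,
    Finset.Nat.antidiagonalTuple_zero_succ, Finset.sum_empty, add_zero, Finset.mul_sum,
    Finset.sum_congr rfl hblocks]
  simp only [Finset.mul_sum]
  refine Finset.sum_comm' fun a r => ?_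
  simp only [Finset.mem_range]
  omega

/-- The binomial transform `∑ᵢ (m choose i) (-c)^(m-i) partitionSum Ψ i`. -/
def centeredSum (c : ℝ) (Ψ : Multiset ℕ → ℝ) (m : ℕ) : ℝ :=
  ∑ i ∈ Finset.range (m + 1), (m.choose i : ℝ) * (-c) ^ (m - i) * partitionSum Ψ i

theorem partitionSum_mul_add (x : ℝ) (Ψ Ψ' : Multiset ℕ → ℝ) (i : ℕ) :
    partitionSum (fun s => x * Ψ s + Ψ' s) i = x * partitionSum Ψ i + partitionSum Ψ' i := by
  simp only [partitionSum, mul_add, Finset.sum_add_distrib, mul_left_comm _ x, ← Finset.mul_sum]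

theorem centeredSum_mul_add (c x : ℝ) (Ψ Ψ' : Multiset ℕ → ℝ) (m : ℕ) :
    centeredSum c (fun s => x * Ψ s + Ψ' s) m = x * centeredSum c Ψ m + centeredSum c Ψ' m := by
  simp only [centeredSum, partitionSum_mul_add, mul_add, Finset.sum_add_distrib,
    mul_left_comm _ x, ← Finset.mul_sum]

theorem centeredSum_succ (c : ℝ) (Ψ : Multiset ℕ → ℝ) (n : ℕ) :
    centeredSum c Ψ (n + 1) = ∑ i ∈ Finset.range (n + 1), (n.choose i : ℝ) * (-c) ^ (n - i) *
      partitionSum Ψ (i + 1) - c * centeredSum c Ψ n := by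
  have hmul : -c * centeredSum c Ψ n = ∑ i ∈ Finset.range (n + 1 + 1),
      (n.choose i : ℝ) * (-c) ^ (n + 1 - i) * partitionSum Ψ i := by
    rw [Finset.sum_range_succ, Nat.choose_succ_self, Nat.cast_zero, zero_mul, zero_mul, add_zero,
      centeredSum, Finset.mul_sum]
    refine Finset.sum_congr rfl fun i hi => ?_
    rw [Nat.succ_sub (Finset.mem_range_succ_iff.1 hi), pow_succ]
    ring
  rw [sub_eq_add_neg, ← neg_mul, hmul, centeredSum, Finset.sum_range_succ',
    Finset.sum_range_succ' (n := n + 1), ← add_assoc, ← Finset.sum_add_distrib]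
  simp only [Nat.choose_succ_succ, Nat.add_sub_add_right, Nat.cast_add, add_mul,
    Nat.choose_zero_right]

theorem sum_choose_mul_partitionSum_succ (c : ℝ) (Φ : Multiset ℕ → ℝ) (n : ℕ) :
    ∑ i ∈ Finset.range (n + 1), (n.choose i : ℝ) * (-c) ^ (n - i) * partitionSum Φ (i + 1) =
      ∑ r ∈ Finset.range (n + 1),
        (n.choose r : ℝ) * centeredSum c (fun m => Φ ((r + 1) ::ₘ m)) (n - r) := by
  let f (r i : ℕ) : ℝ := (n.choose r : ℝ) * (((n - r).choose i : ℝ) * (-c) ^ (n - r - i) *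
    partitionSum (fun m => Φ ((r + 1) ::ₘ m)) i)
  calc _ = ∑ i ∈ Finset.range (n + 1), ∑ r ∈ Finset.range (i + 1), f r (i - r) := by
        simp only [partitionSum_succ, Finset.mul_sum]
        refine Finset.sum_congr rfl fun i _ => Finset.sum_congr rfl fun r hr => ?_
        have hle := Finset.mem_range_succ_iff.1 hr
        have hchoose : (n.choose i : ℝ) * (i.choose r : ℝ) =
            (n.choose r : ℝ) * ((n - r).choose (i - r) : ℝ) := by
          exact_mod_cast Nat.choose_mul hle
        simp only [f, show n - r - (i - r) = n - i by omega]
        linear_combination (-c) ^ (n - i) *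
          partitionSum (fun m => Φ ((r + 1) ::ₘ m)) (i - r) * hchoose
    _ = ∑ r ∈ Finset.range (n + 1), ∑ i ∈ Finset.range (n + 1 - r), f r i :=
        Finset.sum_range_diag_flip _ f
    _ = _ := by
        refine Finset.sum_congr rfl fun r hr => ?_
        rw [Nat.sub_add_comm (Finset.mem_range_succ_iff.1 hr), centeredSum, Finset.mul_sum]

theorem coeffC_cons {n a i r : ℕ} (c : ℕ) {l : Fin a → ℕ} (hl : ∑ p, l p + a = i) :
    coeffC n a c (Fin.cons r l : Fin (a + 1) → ℕ) =
      (-1) ^ c * (n.choose r : ℝ) * ((i + c).choose c : ℝ) * (i ! : ℝ) * blockWeight l := by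
  have hchoose : ((i + c)! : ℝ) = ((i + c).choose c : ℝ) * (i ! : ℝ) * (c ! : ℝ) := by
    exact_mod_cast (Nat.add_choose_mul_factorial_mul_factorial i c).symm
  simp only [coeffC, blockWeight, Fin.cons_zero, Fin.cons_succ, hl, hchoose]
  field_simp

theorem sum_range_tsub_comm {M : Type*} [AddCommMonoid M] (n : ℕ) (f : ℕ → ℕ → ℕ → M) :
    ∑ r ∈ Finset.range (n + 1), ∑ i ∈ Finset.range (n - r + 1), ∑ a ∈ Finset.range (i + 1),
        f r i a =
      ∑ a ∈ Finset.range (n + 1), ∑ b ∈ Finset.Icc a n, ∑ r ∈ Finset.range (n - b + 1),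
        f r (n - b - r + a) a := by
  rw [Finset.sum_sigma', Finset.sum_sigma', Finset.sum_sigma', Finset.sum_sigma']
  refine Finset.sum_bij' (fun x _ => ⟨⟨x.2, n - x.1.1 - x.1.2 + x.2⟩, x.1.1⟩)
    (fun x _ => ⟨⟨x.2, n - x.1.2 - x.2 + x.1.1⟩, x.1.1⟩) ?_ ?_ ?_ ?_ ?_ <;>
    rintro ⟨⟨_, _⟩, _⟩ h <;>
    simp only [Finset.mem_sigma, Finset.mem_range, Finset.mem_Icc, Sigma.mk.injEq] at h ⊢
  · omega
  · omega
  · simp; omega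
  · simp; omega
  · congr 1; omega

theorem sum_choose_mul_centeredSum (c : ℝ) (Ψ : ℕ → Multiset ℕ → ℝ) (n : ℕ) :
    ∑ r ∈ Finset.range (n + 1), (n.choose r : ℝ) * centeredSum c (Ψ (r + 1)) (n - r) =
      ∑ a ∈ Finset.range (n + 1), ∑ b ∈ Finset.Icc a n, ∑ r ∈ Finset.range (n - b + 1),
        ∑ l ∈ antidiagonalTuple a (n - b - r),
          coeffC n a (b - a) (Fin.cons r l : Fin (a + 1) → ℕ) * c ^ (b - a) *
            Ψ (1 + r) (succMultiset l) := by
  simp only [centeredSum, partitionSum, Finset.mul_sum (s := Finset.range _)]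
  rw [sum_range_tsub_comm]
  refine Finset.sum_congr rfl fun a _ => Finset.sum_congr rfl fun b hb =>
    Finset.sum_congr rfl fun r hr => ?_
  simp only [Finset.mem_range, Finset.mem_Icc] at hb hr
  rw [Nat.add_sub_cancel, Finset.mul_sum, Finset.mul_sum, Finset.mul_sum]
  refine Finset.sum_congr rfl fun l hl => ?_
  rw [coeffC_cons (b - a) (congrArg (· + a) (mem_antidiagonalTuple.1 hl)),
    ← Nat.choose_symm_add, show n - b - r + a + (b - a) = n - r by omega,
    show n - r - (n - b - r + a) = b - a by omega, add_comm 1 r, neg_pow c]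
  ring

end Tuples

section SubsetDelta

open Finset.Nat (antidiagonalTuple mem_antidiagonalTuple)

variable (Φ : Multiset ℕ → ℝ) (H : ℕ → ℝ)

/-- The Möbius transform `∑_{T ⊆ S} (∏_{i ∈ S \ T} (-H(kᵢ))) Φ(k_T)` where `k_T` is the multiset of
the values of `k` on `T`. -/
def subsetDelta {ι : Type*} [DecidableEq ι] (k : ι → ℕ) (S : Finset ι) : ℝ :=
  weightedZeta (fun i => -H (k i)) (fun T => Φ (T.val.map k)) S

theorem subsetDelta_map {ι κ : Type*} [DecidableEq ι] [DecidableEq κ] (e : κ ↪ ι) (k : ι → ℕ)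
    (S : Finset κ) : subsetDelta Φ H k (S.map e) = subsetDelta Φ H (k ∘ e) S := by
  simp only [subsetDelta, weightedZeta_map, Finset.map_val, Multiset.map_map, Function.comp_def]

theorem sum_mul_subsetDelta {ι : Type*} [DecidableEq ι] (k : ι → ℕ) (U : Finset ι) :
    ∑ S ∈ U.powerset, (∏ i ∈ U \ S, H (k i)) * subsetDelta Φ H k S = Φ (U.val.map k) :=
  weightedZeta_neg_right (fun i => H (k i)) (fun T => Φ (T.val.map k)) U

/-- The function `m ↦ Φ({k} ∪ m) - H(k) Φ(m)`, which centres a block of size `k`. -/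
def centerBlock (k : ℕ) (m : Multiset ℕ) : ℝ := Φ (k ::ₘ m) - H k * Φ m

theorem subsetDelta_fin_cons (r : ℕ) {n : ℕ} (k : Fin n → ℕ) :
    subsetDelta Φ H (Fin.cons r k : Fin (n + 1) → ℕ) Finset.univ =
      subsetDelta (centerBlock Φ H r) H k Finset.univ := by
  have huniv : (Finset.univ : Finset (Fin (n + 1))) =
      insert 0 (Finset.univ.map (Fin.succEmb n)) := by
    rw [Fin.univ_succ, Finset.cons_eq_insert]
    rfl
  have hcons (T : Finset (Fin n)) :
      ((insert 0 (T.map (Fin.succEmb n))).val.map (Fin.cons r k : Fin (n + 1) → ℕ)) =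
        r ::ₘ T.val.map k := by
    rw [Finset.insert_val_of_notMem (by simp), Multiset.map_cons, Finset.map_val,
      Multiset.map_map]
    rfl
  rw [subsetDelta, huniv, weightedZeta_insert _ _ (by simp), weightedZeta_map, weightedZeta_map]
  simp only [hcons, subsetDelta, Finset.map_val, Multiset.map_map]
  rw [← weightedZeta_const_mul_add]
  refine weightedZeta_congr _ _ fun T _ => ?_
  simp only [centerBlock, Fin.cons_zero, Function.comp_def, Fin.coe_succEmb, Fin.cons_succ]
  ring

/-- The first `j` elements of `Fin a`. -/
def initialIndices (a j : ℕ) : Finset (Fin a) := Finset.univ.filter fun i => (i : ℕ) < j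

theorem card_initialIndices {a j : ℕ} (h : j ≤ a) : (initialIndices a j).card = j := by
  rw [initialIndices, Fin.card_filter_val_lt, min_eq_right h]

theorem initialIndices_eq_map {a j : ℕ} (h : j ≤ a) :
    initialIndices a j = Finset.univ.map (Fin.castLEEmb h) := by
  ext i
  simp only [initialIndices, Finset.mem_filter_univ, Finset.mem_map, Finset.mem_univ, true_and]
  exact ⟨fun hi => ⟨⟨i, hi⟩, rfl⟩, by rintro ⟨p, rfl⟩; exact p.2⟩

theorem exists_perm_map_eq {α : Type*} [Finite α] {S T : Finset α}
    (h : S.card = T.card) : ∃ e : Equiv.Perm α, S.map e.toEmbedding = T := by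
  classical
  cases nonempty_fintype α
  have hcard : Fintype.card {x // x ∈ S} = Fintype.card {x // x ∈ T} := by simpa using h
  refine ⟨(Fintype.equivOfCardEq hcard).extendSubtype,
    Finset.eq_of_subset_of_card_le (fun x hx => ?_) (by rw [Finset.card_map, h])⟩
  obtain ⟨y, hy, rfl⟩ := Finset.mem_map.1 hx
  exact Equiv.extendSubtype_mem _ y hy

theorem sum_antidiagonalTuple_sum_finset {a : ℕ} (m : ℕ) (F : Finset (Fin a) → (Fin a → ℕ) → ℝ)
    (hF : ∀ (e : Equiv.Perm (Fin a)) S l, F S (l ∘ e) = F (S.map e.toEmbedding) l) :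
    ∑ l ∈ antidiagonalTuple a m, ∑ S, F S l =
      ∑ j ∈ Finset.range (a + 1), (a.choose j : ℝ) *
        ∑ l ∈ antidiagonalTuple a m, F (initialIndices a j) l := by
  have hinitial (j : ℕ) (hj : j ∈ Finset.range (a + 1)) (S : Finset (Fin a))
      (hS : S ∈ Finset.powersetCard j (Finset.univ : Finset (Fin a))) :
      ∑ l ∈ antidiagonalTuple a m, F S l =
        ∑ l ∈ antidiagonalTuple a m, F (initialIndices a j) l := by
    obtain ⟨e, rfl⟩ : ∃ e : Equiv.Perm (Fin a), (initialIndices a j).map e.toEmbedding = S :=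
      exists_perm_map_eq (by
        rw [card_initialIndices (Finset.mem_range_succ_iff.1 hj), (Finset.mem_powersetCard.1 hS).2])
    simp only [← sum_antidiagonalTuple_comp_perm m e (F (initialIndices a j)), hF]
  rw [Finset.sum_comm, ← Finset.powerset_univ, Finset.sum_powerset]
  simp only [Finset.card_univ, Fintype.card_fin]
  refine Finset.sum_congr rfl fun j hj => ?_
  rw [Finset.sum_congr rfl (hinitial j hj), Finset.sum_const, Finset.card_powersetCard,
    Finset.card_fin, nsmul_eq_mul]

theorem sum_mul_succMultiset_of_symmetric {a : ℕ} (m : ℕ) (w : (Fin a → ℕ) → ℝ)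
    (hw : ∀ (e : Equiv.Perm (Fin a)) l, w (l ∘ e) = w l) :
    ∑ l ∈ antidiagonalTuple a m, w l * Φ (succMultiset l) =
      ∑ j ∈ Finset.range (a + 1), (a.choose j : ℝ) * ∑ l ∈ antidiagonalTuple a m,
        w l * ((∏ i ∈ Finset.univ \ initialIndices a j, H (1 + l i)) *
          subsetDelta Φ H (fun i => 1 + l i) (initialIndices a j)) := by
  rw [← sum_antidiagonalTuple_sum_finset m (fun S l => w l *
    ((∏ i ∈ Finset.univ \ S, H (1 + l i)) * subsetDelta Φ H (fun i => 1 + l i) S))]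
  · simp only [← Finset.mul_sum, ← Finset.powerset_univ, sum_mul_subsetDelta]
    rfl
  · intro e S l
    have hmap : Finset.univ.map e.toEmbedding \ S.map e.toEmbedding =
        Finset.univ \ S.map e.toEmbedding := by
      rw [Finset.map_univ_equiv]
    rw [hw, subsetDelta_map, ← hmap, ← Finset.map_sdiff, Finset.prod_map]
    rfl

theorem extendZero_val {a : ℕ} (l : Fin (a + 1) → ℕ) (i : Fin (a + 1)) : extendZero l i = l i :=
  dif_pos i.2

theorem extendZero_fin_cons_succ (r : ℕ) {a : ℕ} (l : Fin a → ℕ) (i : Fin a) :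
    extendZero (Fin.cons r l : Fin (a + 1) → ℕ) (i + 1) = l i :=
  extendZero_val (Fin.cons r l) i.succ

theorem prod_compl_initialIndices (r : ℕ) {a : ℕ} (j : ℕ) (l : Fin a → ℕ) :
    ∏ i ∈ Finset.univ \ initialIndices a j, H (1 + l i) =
      ∏ q ∈ Finset.Icc (j + 1) a, H (1 + extendZero (Fin.cons r l : Fin (a + 1) → ℕ) q) := by
  refine Finset.prod_bij' (fun i _ => (i : ℕ) + 1)
    (fun q hq => ⟨q - 1, by rw [Finset.mem_Icc] at hq; omega⟩) (fun i hi => ?_) (fun q hq => ?_)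
    (fun i _ => rfl) (fun q hq => ?_) fun i _ => by rw [extendZero_fin_cons_succ]
  · simp only [initialIndices, Finset.mem_sdiff, Finset.mem_filter_univ] at hi
    rw [Finset.mem_Icc]
    omega
  · rw [Finset.mem_Icc] at hq
    simp only [initialIndices, Finset.mem_sdiff, Finset.mem_univ, Finset.mem_filter_univ, true_and]
    omega
  · rw [Finset.mem_Icc] at hq
    exact Nat.sub_add_cancel (by omega)

theorem subsetDelta_centerBlock_initialIndices (r : ℕ) {a j : ℕ} (hj : j ≤ a) (l : Fin a → ℕ) :
    subsetDelta (centerBlock Φ H (1 + r)) H (fun i => 1 + l i) (initialIndices a j) =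
      subsetDelta Φ H
        (fun p : Fin (j + 1) => 1 + extendZero (Fin.cons r l : Fin (a + 1) → ℕ) p)
        Finset.univ := by
  rw [initialIndices_eq_map hj, subsetDelta_map, ← subsetDelta_fin_cons]
  congr 1
  refine funext (Fin.cases rfl fun p => ?_)
  rw [Fin.cons_succ, Fin.val_succ]
  exact congrArg (1 + ·) (extendZero_fin_cons_succ r l (Fin.castLE hj p)).symm

theorem prod_Icc_extendZero {a b j : ℕ} (hj : j ≤ a) (hb : a ≤ b) (l : Fin (a + 1) → ℕ) :
    ∏ q ∈ Finset.Icc (j + 1) b, H (1 + extendZero l q) =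
      H 1 ^ (b - a) * ∏ q ∈ Finset.Icc (j + 1) a, H (1 + extendZero l q) := by
  induction b, hb using Nat.le_induction with
  | base => simp
  | succ b hb ih =>
    have hzero : extendZero l (b + 1) = 0 := dif_neg (by omega)
    rw [Finset.prod_Icc_succ_top (by omega), ih, hzero, Nat.sub_add_comm hb, pow_succ]
    ring

theorem sum_choose_mul_centeredSum_cons (n : ℕ) :
    ∑ r ∈ Finset.range (n + 1),
        (n.choose r : ℝ) * centeredSum (H 1) (fun m => Φ ((r + 1) ::ₘ m)) (n - r) =
      ∑ k ∈ Finset.range (n + 1), (n.choose k : ℝ) * H (n - k + 1) * centeredSum (H 1) Φ k +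
      ∑ r ∈ Finset.range (n + 1),
        (n.choose r : ℝ) * centeredSum (H 1) (centerBlock Φ H (r + 1)) (n - r) := by
  have hcenter (r : ℕ) : centeredSum (H 1) (fun m => Φ ((r + 1) ::ₘ m)) (n - r) =
      H (r + 1) * centeredSum (H 1) Φ (n - r) +
        centeredSum (H 1) (centerBlock Φ H (r + 1)) (n - r) := by
    simp only [← centeredSum_mul_add, centerBlock, add_sub_cancel]
  simp only [hcenter, mul_add, Finset.sum_add_distrib, add_left_inj]
  rw [← Finset.sum_range_reflect]
  refine Finset.sum_congr rfl fun k hk => ?_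
  have hle := Finset.mem_range_succ_iff.1 hk
  rw [Nat.add_sub_cancel, Nat.sub_sub_self hle, Nat.choose_symm hle, mul_assoc]

theorem sum_choose_mul_centeredSum_centerBlock (n : ℕ) :
    ∑ r ∈ Finset.range (n + 1),
        (n.choose r : ℝ) * centeredSum (H 1) (centerBlock Φ H (r + 1)) (n - r) =
      ∑ a ∈ Finset.range (n + 1), ∑ j ∈ Finset.range (a + 1), ∑ b ∈ Finset.Icc a n,
        ∑ l ∈ antidiagonalTuple (a + 1) (n - b),
          (a.choose j : ℝ) * coeffC n a (b - a) l *
          (∏ q ∈ Finset.Icc (j + 1) b, H (1 + extendZero l q)) *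
          subsetDelta Φ H (fun p : Fin (j + 1) => 1 + extendZero l p) Finset.univ := by
  rw [sum_choose_mul_centeredSum]
  refine Finset.sum_congr rfl fun a _ => ?_
  rw [Finset.sum_comm]
  refine Finset.sum_congr rfl fun b hb => ?_
  simp only [sum_antidiagonalTuple_succ]
  rw [Finset.sum_comm (s := Finset.range (a + 1))]
  refine Finset.sum_congr rfl fun r _ => ?_
  rw [sum_mul_succMultiset_of_symmetric (centerBlock Φ H (1 + r)) H (n - b - r) (fun l =>
    coeffC n a (b - a) (Fin.cons r l : Fin (a + 1) → ℕ) * H 1 ^ (b - a)) fun e l => by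
      rw [coeffC_cons _ rfl, coeffC_cons _ rfl, blockWeight_comp_perm,
        show ∑ p, (l ∘ e) p = ∑ p, l p from Equiv.sum_comp e l]]
  refine Finset.sum_congr rfl fun j hj => ?_
  have hle := Finset.mem_range_succ_iff.1 hj
  rw [Finset.mul_sum]
  refine Finset.sum_congr rfl fun l _ => ?_
  rw [subsetDelta_centerBlock_initialIndices Φ H r hle, prod_compl_initialIndices H r,
    prod_Icc_extendZero H hle (Finset.mem_Icc.1 hb).1]
  ring

end SubsetDelta

section Skorohod

open Finset.Nat (antidiagonalTuple mem_antidiagonalTuple)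

theorem exists_equiv_of_map_eq {ι κ α : Type*} [Fintype ι] [Fintype κ] {f : ι → α} {g : κ → α}
    (h : Finset.univ.val.map f = Finset.univ.val.map g) : ∃ e : ι ≃ κ, g ∘ e = f := by
  classical
  have hcard (n : α) : Fintype.card {i // f i = n} = Fintype.card {i // g i = n} := by
    have hcount := congrArg (Multiset.count n) h
    rw [Multiset.count_map, Multiset.count_map] at hcount
    rw [Fintype.card_subtype, Fintype.card_subtype, Finset.card, Finset.card, Finset.filter_val,
      Finset.filter_val]
    simpa only [eq_comm] using hcount
  let e (n : α) : {i // f i = n} ≃ {i // g i = n} := Fintype.equivOfCardEq (hcard n)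
  exact ⟨(Equiv.sigmaFiberEquiv f).symm.trans
    ((Equiv.sigmaCongrRight e).trans (Equiv.sigmaFiberEquiv g)),
    funext fun i => (e (f i) ⟨i, rfl⟩).2⟩

/-- The joint moment whose exponents are the elements of the multiset `m`. -/
def multisetMoment {X : Type*} [TopologicalSpace X] [MeasurableSpace X] (σ : Measure X)
    (π : Measure (Configuration X)) (u : Configuration X → X → ℝ) (m : Multiset ℕ) : ℝ :=
  jointMoment σ π u m.toList.get

theorem skorohod_ae_eq {X : Type*} [TopologicalSpace X] [SigmaCompactSpace X] [MeasurableSpace X]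
    {σ : Measure X} [NullSingletonClass σ] {π : Measure (Configuration X)}
    {u : Configuration X → X → ℝ} {N : ℕ} {A : ℕ → ℝ≥0} {H : ℕ → ℝ}
    (hu : ∀ᵐ ω ∂π, HasMoments σ N A H (u ω)) :
    skorohod σ u =ᵐ[π] fun ω => ∫ t, u (ω.erase t) t ∂ω.toMeasure - H 1 := by
  filter_upwards [hu] with ω hω
  have hcompensator : ∫ t, u (ω.erase t) t ∂σ = H 1 := by
    rw [← (hω 1 le_rfl (by omega)).2]
    refine integral_congr_ae ?_
    filter_upwards [ae_notMem_carrier σ ω] with t ht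
    rw [erase_eq ht, pow_one]
  rw [skorohod, hcompensator]

theorem sum_one_add_extendZero_le {n a b j : ℕ} (hb : b ∈ Finset.Icc a n)
    (hj : j ∈ Finset.range (a + 1)) {l : Fin (a + 1) → ℕ}
    (hl : l ∈ antidiagonalTuple (a + 1) (n - b)) :
    ∑ p : Fin (j + 1), (1 + extendZero l p) ≤ n + 1 := by
  rw [Finset.mem_Icc] at hb
  rw [Finset.mem_range] at hj
  have hsum : ∑ p : Fin (j + 1), extendZero l p ≤ n - b := calc
    ∑ p : Fin (j + 1), extendZero l p
        = ∑ p ∈ Finset.range (j + 1), extendZero l p := Fin.sum_univ_eq_sum_range _ _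
    _ ≤ ∑ p ∈ Finset.range (a + 1), extendZero l p :=
        Finset.sum_le_sum_of_subset (Finset.range_mono hj)
    _ = ∑ p, l p := by
        simp only [← Fin.sum_univ_eq_sum_range, extendZero_val]
    _ = n - b := mem_antidiagonalTuple.1 hl
  simp only [Finset.sum_add_distrib, Finset.sum_const, Finset.card_fin, smul_eq_mul]
  omega

variable {X : Type*} [TopologicalSpace X] [T2Space X] [SecondCountableTopology X]
  [SigmaCompactSpace X] [MeasurableSpace X] [OpensMeasurableSpace X]
  {σ : Measure X} [SigmaFinite σ] {π : Measure (Configuration X)}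
  {u : Configuration X → X → ℝ}

theorem multisetMoment_map [IsProbabilityMeasure π] (hu : Measurable (Function.uncurry u))
    {ι : Type*} [Fintype ι] [DecidableEq ι] (k : ι → ℕ) :
    multisetMoment σ π u (Finset.univ.val.map k) = jointMoment σ π u k := by
  obtain ⟨e, he⟩ := exists_equiv_of_map_eq (f := (Finset.univ.val.map k).toList.get) (g := k)
    (by rw [Fin.univ_val_map, List.ofFn_get, Multiset.coe_toList])
  rw [multisetMoment, ← he, jointMoment_comp_equiv hu e k]

namespace IsMomentProcess

variable [NullSingletonClass σ] {N : ℕ} {A : ℕ → ℝ≥0} {H : ℕ → ℝ}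
  (h : IsMomentProcess σ π u N A H)
include h

theorem integral_bigDelta_eq_subsetDelta {m : ℕ} (k : Fin m → ℕ) (hk : ∀ i, 1 ≤ k i)
    (hs : ∑ i, k i ≤ N + 1) :
    ∫ ω, ∫ s : Fin m → X, bigDelta (powProcess u k) s ω ∂(Measure.pi fun _ => σ) ∂π =
      subsetDelta (multisetMoment σ π u) H k Finset.univ := by
  have := h.isPoisson.isProbabilityMeasure
  rw [h.integral_bigDelta k hk hs, subsetDelta]
  refine weightedZeta_congr _ _ fun S _ => ?_
  rw [← multisetMoment_map h.measurable]
  exact congrArg _ (Multiset.attach_map_val' S.val k)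

theorem mixedMoment_eq_partitionSum (i : ℕ) {n : ℕ} (k : Fin n → ℕ) (hk : ∀ p, 1 ≤ k p)
    (hs : ∑ p, k p + i ≤ N + 1) :
    mixedMoment σ π u k i =
      partitionSum (fun m => multisetMoment σ π u (m + Finset.univ.val.map k)) i := by
  have := h.isPoisson.isProbabilityMeasure
  induction i using Nat.strong_induction_on generalizing n with
  | _ i ih =>
  rcases i with _ | i
  · rw [mixedMoment_zero, partitionSum_zero, zero_add, multisetMoment_map h.measurable]
  · rw [h.mixedMoment_succ k i hk hs, partitionSum_succ]
    refine Finset.sum_congr rfl fun r hr => ?_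
    have hcons : Finset.univ.val.map (Fin.cons (r + 1) k : Fin (n + 1) → ℕ) =
        (r + 1) ::ₘ Finset.univ.val.map k := by
      simp [Fin.univ_val_map, List.ofFn_succ]
    rw [Finset.mem_range] at hr
    rw [ih (i - r) (by omega) _ (Fin.cases (by simp) fun p => by simpa using hk p)
      (by rw [Fin.sum_cons]; omega)]
    simp only [hcons, Multiset.add_cons, Multiset.cons_add]

theorem integrable_integral_erase_pow (i : ℕ) (hi : i ≤ N + 1) :
    Integrable (fun ω => (∫ t, u (ω.erase t) t ∂ω.toMeasure) ^ i) π := by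
  have := h.isPoisson.isProbabilityMeasure
  have : IsProbabilityMeasure (Measure.pi fun _ : Fin 0 => σ) := ⟨by simp⟩
  have hmixed := h.integrable_mixedMoment i (Fin.elim0 : Fin 0 → ℕ) (fun p => p.elim0) (by simpa)
  simp only [shiftProd, shiftedIntegral, Finset.univ_eq_empty, Finset.prod_empty, one_mul,
    addPoints_empty] at hmixed
  exact hmixed.of_comp_fst (IsProbabilityMeasure.ne_zero _)

theorem integral_integral_erase_pow (i : ℕ) (hi : i ≤ N + 1) :
    ∫ ω, (∫ t, u (ω.erase t) t ∂ω.toMeasure) ^ i ∂π =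
      partitionSum (multisetMoment σ π u) i := by
  have := h.isPoisson.isProbabilityMeasure
  have : IsProbabilityMeasure (Measure.pi fun _ : Fin 0 => σ) := ⟨by simp⟩
  have hmixed := h.mixedMoment_eq_partitionSum i (Fin.elim0 : Fin 0 → ℕ) (fun p => p.elim0)
    (by simpa)
  simp only [mixedMoment, shiftProd, shiftedIntegral, Finset.univ_eq_empty, Finset.prod_empty,
    one_mul, addPoints_empty, Finset.empty_val, Multiset.map_zero, add_zero] at hmixed
  rw [← hmixed, integral_fun_fst fun ω : Configuration X =>
    (∫ t, u (ω.erase t) t ∂ω.toMeasure) ^ i, probReal_univ, one_smul]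

theorem memLp_skorohod (n : ℕ) (hn : n ≤ N) : MemLp (skorohod σ u) ((n : ℝ≥0∞) + 1) π := by
  have := h.isPoisson.isProbabilityMeasure
  have hpow := (h.integrable_integral_erase_pow (n + 1) (by omega)).2
  simp only [HasFiniteIntegral, enorm_pow] at hpow
  rw [← eLpNorm_natCast_add_one_pow] at hpow
  refine MemLp.ae_eq (skorohod_ae_eq h.hasMoments).symm (MemLp.sub
    ⟨(measurable_integral_erase h.measurable).aestronglyMeasurable, ?_⟩ (memLp_const _))
  exact (ENNReal.pow_lt_top_iff.1 hpow).resolve_right (by omega)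

theorem integral_skorohod_pow (m : ℕ) (hm : m ≤ N + 1) :
    ∫ ω, skorohod σ u ω ^ m ∂π = centeredSum (H 1) (multisetMoment σ π u) m := by
  have hbinomial : ∀ᵐ ω ∂π, skorohod σ u ω ^ m = ∑ i ∈ Finset.range (m + 1),
      (m.choose i : ℝ) * (-H 1) ^ (m - i) * (∫ t, u (ω.erase t) t ∂ω.toMeasure) ^ i := by
    filter_upwards [skorohod_ae_eq h.hasMoments] with ω hω
    rw [hω, sub_eq_add_neg, add_pow]
    exact Finset.sum_congr rfl fun i _ => by ring
  have hle (i : ℕ) (hi : i ∈ Finset.range (m + 1)) : i ≤ N + 1 :=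
    (Finset.mem_range_succ_iff.1 hi).trans hm
  rw [integral_congr_ae hbinomial, integral_finsetSum _ fun i hi =>
    (h.integrable_integral_erase_pow i (hle i hi)).const_mul _, centeredSum]
  refine Finset.sum_congr rfl fun i hi => ?_
  rw [integral_const_mul, h.integral_integral_erase_pow i (hle i hi)]

theorem integral_skorohod_pow_succ (n : ℕ) (hn : n ≤ N) :
    ∫ ω, skorohod σ u ω ^ (n + 1) ∂π =
      ∑ k ∈ Finset.range n,
        (n.choose k : ℝ) * H (n - k + 1) * ∫ ω, skorohod σ u ω ^ k ∂π +
      ∑ a ∈ Finset.range (n + 1), ∑ j ∈ Finset.range (a + 1), ∑ b ∈ Finset.Icc a n,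
        ∑ l ∈ antidiagonalTuple (a + 1) (n - b),
          (a.choose j : ℝ) * coeffC n a (b - a) l *
          (∏ q ∈ Finset.Icc (j + 1) b, H (1 + extendZero l q)) *
          ∫ ω, ∫ s : Fin (j + 1) → X,
            bigDelta (powProcess u fun p : Fin (j + 1) => 1 + extendZero l p) s ω
            ∂(Measure.pi fun _ => σ) ∂π := by
  have hmoment (k : ℕ) (hk : k ∈ Finset.range n) :
      (n.choose k : ℝ) * H (n - k + 1) * ∫ ω, skorohod σ u ω ^ k ∂π =
        (n.choose k : ℝ) * H (n - k + 1) * centeredSum (H 1) (multisetMoment σ π u) k := by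
    rw [Finset.mem_range] at hk
    rw [h.integral_skorohod_pow k (by omega)]
  rw [h.integral_skorohod_pow (n + 1) (by omega), centeredSum_succ,
    sum_choose_mul_partitionSum_succ, sum_choose_mul_centeredSum_cons, Finset.sum_range_succ,
    sum_choose_mul_centeredSum_centerBlock, Finset.sum_congr rfl hmoment, Nat.choose_self,
    Nat.sub_self, Nat.cast_one, one_mul, add_sub_right_comm, add_sub_cancel_right]
  refine congrArg _ (Finset.sum_congr rfl fun a _ => Finset.sum_congr rfl fun j hj =>
    Finset.sum_congr rfl fun b hb => Finset.sum_congr rfl fun l hl => ?_)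
  rw [h.integral_bigDelta_eq_subsetDelta _ (fun p => by omega)
    ((sum_one_add_extendZero_le hb hj hl).trans (by omega))]

end IsMomentProcess

end Skorohod

end PoissonInvariance

end

open PoissonInvariance in
theorem proposition3p1_general
    {X : Type*} [TopologicalSpace X] [T2Space X] [SecondCountableTopology X]
    [SigmaCompactSpace X] [MeasurableSpace X] [OpensMeasurableSpace X]
    (σ : Measure X) [SigmaFinite σ] [NullSingletonClass σ]
    (π : Measure (Configuration X)) (hπ : IsPoisson σ π)
    (N : ℕ) (u : Configuration X → X → ℝ) (hu : Measurable (Function.uncurry u))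
    (A : ℕ → ℝ≥0) (H : ℕ → ℝ) (hmoments : ∀ᵐ ω ∂π, HasMoments σ N A H (u ω))
    (hbound : ∀ (a : ℕ) (l : Fin (a + 1) → ℕ), (∀ p, 1 ≤ l p) → ∑ p, l p ≤ N + 1 →
      ∫⁻ ω, ∫⁻ s : Fin (a + 1) → X, ‖bigDelta (fun p η x => u η x ^ l p) s ω‖ₑ
        ∂(Measure.pi fun _ => σ) ∂π < ∞)
    (n : ℕ) (hn : n ≤ N) :
    MemLp (skorohod σ u) ((n : ℝ≥0∞) + 1) π ∧
    ∫ ω, skorohod σ u ω ^ (n + 1) ∂π =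
      ∑ k ∈ Finset.range n,
        (n.choose k : ℝ) * H (n - k + 1) * ∫ ω, skorohod σ u ω ^ k ∂π +
      ∑ a ∈ Finset.range (n + 1), ∑ j ∈ Finset.range (a + 1), ∑ b ∈ Finset.Icc a n,
        ∑ l ∈ Finset.Nat.antidiagonalTuple (a + 1) (n - b),
          (a.choose j : ℝ) * coeffC n a (b - a) l *
          (∏ q ∈ Finset.Icc (j + 1) b, H (1 + extendZero l q)) *
          ∫ ω, ∫ s : Fin (j + 1) → X,
            bigDelta (fun p η x => u η x ^ (1 + extendZero l p)) s ω
            ∂(Measure.pi fun _ => σ) ∂π :=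
  have h : IsMomentProcess σ π u N A H := ⟨hπ, hu, hmoments, hbound⟩
  ⟨h.memLp_skorohod n hn, h.integral_skorohod_pow_succ n hn⟩

theorem proposition3p1
    {X : Type*} [MetricSpace X] [SigmaCompactSpace X] [MeasurableSpace X] [BorelSpace X]
    (σ : Measure X) [SigmaFinite σ] [NullSingletonClass σ]
    {Y : Type*} [MeasurableSpace Y] (μ : Measure Y)
    (π : Measure (PoissonInvariance.Configuration X)) (hπ : PoissonInvariance.IsPoisson σ π)
    (N : ℕ) (R : PoissonInvariance.RandomIsometry N μ σ)
    (h : Y → ℝ) (hh : ∀ p : Fin (N + 1), MemLp h (((p : ℕ) : ℝ≥0∞) + 1) μ)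
    (u : PoissonInvariance.Configuration X → X → ℝ)
    (hu : PoissonInvariance.IsVersion π R h hh u)
    (hu_mem : PoissonInvariance.MemL21 σ π u)
    (hu_bdd : ∃ M : ℝ, ∀ᵐ ω ∂π, ∀ᵐ x ∂σ, |u ω x| ≤ M)
    (hbound : ∀ (a : ℕ) (l : Fin (a + 1) → ℕ), (∀ p, 1 ≤ l p) → ∑ p, l p ≤ N + 1 →
      ∫⁻ ω, ∫⁻ s : Fin (a + 1) → X,
          ‖PoissonInvariance.bigDelta (fun p η x => u η x ^ l p) s ω‖ₑ
        ∂(Measure.pi fun _ => σ) ∂π < ∞)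
    (n : ℕ) (hn : n ≤ N) :
    MemLp (PoissonInvariance.skorohod σ u) ((n : ℝ≥0∞) + 1) π ∧
    ∫ ω, PoissonInvariance.skorohod σ u ω ^ (n + 1) ∂π =
      ∑ k ∈ Finset.range n,
        (n.choose k : ℝ) * (∫ y, h y ^ (n - k + 1) ∂μ) *
          ∫ ω, PoissonInvariance.skorohod σ u ω ^ k ∂π +
      ∑ a ∈ Finset.range (n + 1), ∑ j ∈ Finset.range (a + 1), ∑ b ∈ Finset.Icc a n,
        ∑ l ∈ Finset.Nat.antidiagonalTuple (a + 1) (n - b),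
          (a.choose j : ℝ) * PoissonInvariance.coeffC n a (b - a) l *
          (∏ q ∈ Finset.Icc (j + 1) b,
            ∫ y, h y ^ (1 + PoissonInvariance.extendZero l q) ∂μ) *
          ∫ ω, ∫ s : Fin (j + 1) → X,
            PoissonInvariance.bigDelta
              (fun p η x => u η x ^ (1 + PoissonInvariance.extendZero l p)) s ω
            ∂(Measure.pi fun _ => σ) ∂π :=
  proposition3p1_general σ π hπ N u hu_mem.measurable _ _ hu.hasMoments hbound n hn
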